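/- **Setting.** Let $d\ge 1$, let $\Omega\subset\mathbb R^d$ satisfy $\Omega=\operatorname{int}\overline\Omega$, and let $\mathcal T$ be a conforming triangulation of $\Omega$: finitely many $d$-simplices whose closures cover $\overline\Omega$ and meet pairwise in a (possibly empty) common sub-simplex. Let $\mathcal E$ be the set of interfaces (facets common to two cells), and call the facets contained in $\partial\Omega$ boundary faces. With $n_T$ the outer unit normal of the cell $T$, set on an interface $e=\overline T_1\cap\overline T_2$ $$\{u\}=\tfrac12(u|_{T_1}+u|_{T_2}),\quad [\![\Phi]\!]=\Phi|_{T_1}n_{T_1}+\Phi|_{T_2}n_{T_2},\quad [\![u]\!]=u|_{T_1}\!\cdot n_{T_1}+u|_{T_2}\!\cdot n_{T_2},\quad [\![u]\!]_\otimes=u|_{T_1}\!\otimes n_{T_1}+u|_{T_2}\!\otimes n_{T_2}$$ for scalar $\Phi$ and vector-valued $u$ (averages are also taken of scalars and matrices), and use the one-sided expressions on boundary faces. For $k\in\mathbb N$ let $V_h$ be the space of functions that are polynomials of degree at most $k$ on every cell, $(V_{h,0})^d$ the fields in $(V_h)^d$ with zero trace on $\partial\Omega$, $V_{h,n}$ the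 fields in $(V_h)^d$ with zero normal trace on $\partial\Omega$, and $\mathcal V_h=V_h\times(V_{h,0})^d\times V_h\times V_h\times V_h\times V_{h,n}$. All derivatives in space are taken cell by cell. **Model.** Let $\gamma,\eta>0$; let $\tilde f(\rho,\varphi)$ be $C^1$ on $(0,\infty)\times[0,1]$; let $S(A,\varphi)=\nu(\varphi)(A+A^{\top})+\lambda(\varphi)\operatorname{tr}(A)I$ with $\nu,\lambda$ continuous on $[0,1]$ and $\nu>0$. For $\alpha_B>0$ put $$B_h[\varphi;v,X]=\int_\Omega S(\nabla v,\varphi):\nabla X\,dx-\int_{\mathcal E\cup\partial\Omega}\{S(\nabla v,\varphi)\}:[\![X]\!]_\otimes+\{S(\nabla X,\varphi)\}:[\![v]\!]_\otimes\,ds+\int_{\mathcal E\cup\partial\Omega}\frac{\alpha_B}{|e|}[\![v]\!]_\otimes:[\![X]\!]_\otimes\,ds .$$ The parameter $\alpha_B$ is assumed to be so big that $B_h[\varphi;\cdot,\cdot]$ is coercive on $(V_{h,0})^d$ for every $\varphi\in V_h$ with values in $[0,1]$, i.e. there is $c>0$ with $B_h[\varphi;v,v]\ge c\,\big(\int_\Omega|\nabla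 v|^2dx+\int_{\mathcal E\cup\partial\Omega}|e|^{-1}|[\![v]\!]_\otimes|^2ds\big)$ for all $v\in(V_{h,0})^d$. **Scheme.** A general semi-discrete dG approximation with fluxes $F_1,\dots,F_6$ is a curve $U_h=(\rho_h,v_h,\varphi_h,\mu_h,\tau_h,\sigma_h)\in C^0([0,T];\mathcal V_h)$, with $\rho_h,v_h,\varphi_h,\sigma_h$ differentiable in time, such that for every $t\in[0,T]$ one has $\varphi_h(t)\in[0,1]$ and $\rho_h(t)>0$ on every closed cell (traces included), and such that for all $t\in(0,T)$ and all $(\psi,X,\Theta,\chi,\zeta,Z)\in\mathcal V_h$ $$\begin{aligned} 0&=\int_\Omega(\partial_t\rho_h+\operatorname{div}(\rho_hv_h))\psi\,dx+\int_{\mathcal E}F_1[U_h,\psi]\,ds,\\ 0&=\int_\Omega\big(\rho_h\partial_tv_h+\operatorname{div}(\rho_hv_h\otimes v_h)-\operatorname{div}(\rho_hv_h)v_h+\rho_h\nabla\tau_h-\mu_h\nabla\varphi_h-\tfrac12\rho_h\nabla|v_h|^2\big)\cdot X\,dx+\int_{\mathcal E}F_2[U_h,X]\,ds+B_h[\varphi_h;v_h,X],\\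 0&=\int_\Omega\big(\partial_t\varphi_h+v_h\cdot\nabla\varphi_h+\eta\tfrac{\mu_h}{\rho_h}\big)\Theta\,dx+\int_{\mathcal E}F_3[U_h,\Theta]\,ds,\\ 0&=\int_\Omega\big(\mu_h-\tfrac{\partial(\rho\tilde f)}{\partial\varphi}(\rho_h,\varphi_h)+\gamma\operatorname{div}\sigma_h\big)\chi\,dx+\int_{\mathcal E}F_4[U_h,\chi]\,ds,\\ 0&=\int_\Omega\big(\tau_h-\tfrac{\partial(\rho\tilde f)}{\partial\rho}(\rho_h,\varphi_h)-\tfrac12|v_h|^2\big)\zeta\,dx+\int_{\mathcal E}F_5[U_h,\zeta]\,ds,\\ 0&=\int_\Omega(\sigma_h-\nabla\varphi_h)\cdot Z\,dx+\int_{\mathcal E}F_6[U_h,Z]\,ds . \end{aligned}$$ **Corollary (stabilized semi-discrete dG approximation).** Let $\alpha_1,\alpha_2,\alpha_3\ge0$ and let $$\begin{aligned} F_1&=-[\![\rho_hv_h]\!]\{\psi\}+\alpha_1[\![\tau_h]\!]\cdot[\![\psi]\!], & F_4&=-\gamma[\![\sigma_h]\!]\{\chi\},\\ F_2&=-[\![\tau_h]\!]\cdot\{\rho_hX\}+[\![\varphi_h]\!]\cdot\{\mu_hX\}+\alpha_2[\![v_h]\!][\![X]\!],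 & F_5&=0,\\ F_3&=-[\![\varphi_h]\!]\cdot\{\Theta v_h\}+\alpha_3[\![\mu_h]\!]\cdot[\![\Theta]\!], & F_6&=[\![\varphi_h]\!]\cdot\{Z\}. \end{aligned}$$ Then for every general semi-discrete dG approximation $U_h$ with these fluxes, the energy $$\hat E_h(t)=\int_\Omega\rho_h\tilde f(\rho_h,\varphi_h)+\tfrac\gamma2|\sigma_h|^2+\tfrac{\rho_h}2|v_h|^2\,dx$$ is differentiable on $(0,T)$, and for all $t\in(0,T)$ $$\frac{d}{dt}\hat E_h(t)=-\int_\Omega\frac{\eta}{\rho_h}\mu_h^2\,dx-B_h[\varphi_h;v_h,v_h]-\int_{\mathcal E}\alpha_1|[\![\tau_h]\!]|^2+\alpha_2[\![v_h]\!]^2+\alpha_3|[\![\mu_h]\!]|^2\,ds\;\le\;0 .$$ -/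

import Mathlib

namespace NSAC

noncomputable section

open Set MeasureTheory
open scoped Gradient

/-- Points and vectors of `ℝ^d` with the Euclidean structure. -/
abbrev Vec (d : ℕ) := EuclideanSpace ℝ (Fin d)

/-! ### Conforming triangulations -/

/-- A conforming triangulation of `Ω ⊆ ℝ^d` by finitely many `d`-simplices. A cell is recorded by
its finite set `T` of `d + 1` vertices; the closed simplex is `convexHull ℝ T`. -/
structure Triangulation (d : ℕ) (Ω : Set (Vec d)) where
  cells : Finset (Finset (Vec d))
  card_eq : ∀ T ∈ cells, T.card = d + 1
  affineIndependent : ∀ T ∈ cells, AffineIndependent ℝ ((↑) : {x // x ∈ T} → Vec d)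
  /-- two closed simplices meet in a (possibly empty) common sub-simplex -/
  conforming : ∀ T₁ ∈ cells, ∀ T₂ ∈ cells, ∃ S : Finset (Vec d), S ⊆ T₁ ∧ S ⊆ T₂ ∧
    convexHull ℝ (T₁ : Set (Vec d)) ∩ convexHull ℝ (T₂ : Set (Vec d)) =
      convexHull ℝ (S : Set (Vec d))
  cover : ⋃ T ∈ cells, convexHull ℝ (T : Set (Vec d)) = closure Ω

variable {d : ℕ} {Ω : Set (Vec d)}

namespace Triangulation

variable (M : Triangulation d Ω)

/-- The type of cells of the triangulation. -/
abbrev Cell := {T : Finset (Vec d) // T ∈ M.cells}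

open Classical in
/-- The facets (`(d-1)`-dimensional closed faces, recorded by their `d` vertices) of all cells. -/
def facets : Finset (Finset (Vec d)) :=
  M.cells.biUnion fun T => T.powersetCard d

open Classical in
/-- The set `𝓔` of interfaces: facets common to two distinct cells. -/
def interfaces : Finset (Finset (Vec d)) :=
  M.facets.filter fun F => ∃ T₁ ∈ M.cells, ∃ T₂ ∈ M.cells, T₁ ≠ T₂ ∧ F ⊆ T₁ ∧ F ⊆ T₂

open Classical in
/-- The boundary faces: facets that lie in `∂Ω`. -/
def boundaryFaces : Finset (Finset (Vec d)) :=
  M.facets.filter fun F => convexHull ℝ (F : Set (Vec d)) ⊆ frontier Ω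

open Classical in
/-- The cells that have the facet `F`: two for an interface, one for a boundary face. -/
def cellsAt (F : Finset (Vec d)) : Finset M.Cell :=
  Finset.univ.filter fun T => F ⊆ T.1

end Triangulation

/-- The outer unit normal `n_T` of the simplex with vertex set `T` on its facet `F`: the
normalized component, orthogonal to the facet, of the vector from the barycentre of `T` to
the barycentre of `F`. -/
def outerNormal (T F : Finset (Vec d)) : Vec d :=
  let w : Vec d := (vectorSpan ℝ (F : Set (Vec d)))ᗮ.starProjection
    (F.centroid ℝ id - T.centroid ℝ id)
  ‖w‖⁻¹ • w

/-- Surface integral `∫_F g ds` over a facet, with respect to the `(d-1)`-dimensional Hausdorff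
measure (normalized to agree with Lebesgue measure on `(d-1)`-planes). -/
def faceIntegral (F : Finset (Vec d)) (g : Vec d → ℝ) : ℝ :=
  ∫ x in convexHull ℝ (F : Set (Vec d)), g x ∂(Measure.euclideanHausdorffMeasure (d - 1))

/-- The `(d-1)`-dimensional measure `|F|` of a facet. -/
def faceArea (F : Finset (Vec d)) : ℝ :=
  (Measure.euclideanHausdorffMeasure (d - 1) : Measure (Vec d)).real
    (convexHull ℝ (F : Set (Vec d)))

/-! ### Broken functions, jumps, averages and integrals -/

/-- A broken function: on every cell `T` a function. The functions used are polynomials on each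
cell, given with their polynomial extension, so that the trace on a facet of `T` of the
restriction to `T` is just the restriction of `u T` to the facet. -/
abbrev Broken (M : Triangulation d Ω) (V : Type) := M.Cell → Vec d → V

variable {M : Triangulation d Ω}

/-- `∫_Ω g dx`, the sum of the integrals over the cells. -/
def domainIntegral (g : Broken M ℝ) : ℝ :=
  ∑ T : M.Cell, ∫ x in convexHull ℝ (T.1 : Set (Vec d)), g T x

variable (M) in
/-- `∫_𝓔 G ds`, the sum of the integrals over the interfaces. -/
def interfaceIntegral (G : Finset (Vec d) → Vec d → ℝ) : ℝ :=
  ∑ F ∈ M.interfaces, faceIntegral F (G F)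

variable (M) in
/-- `∫_{𝓔 ∪ ∂Ω} G ds`. -/
def skeletonIntegral (G : Finset (Vec d) → Vec d → ℝ) : ℝ :=
  ∑ F ∈ M.interfaces, faceIntegral F (G F) + ∑ F ∈ M.boundaryFaces, faceIntegral F (G F)

/-- The average `{u}` on a facet: `(u|_{T₁} + u|_{T₂}) / 2` on an interface and `u|_T` on a
boundary face. -/
def avg {V : Type} [AddCommGroup V] [Module ℝ V] (u : Broken M V) (F : Finset (Vec d))
    (x : Vec d) : V :=
  ((M.cellsAt F).card : ℝ)⁻¹ • ∑ T ∈ M.cellsAt F, u T x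

/-- The vector-valued jump `⟦u⟧` of a scalar function: `u|_{T₁} n_{T₁} + u|_{T₂} n_{T₂}` on an
interface and `u|_T n_T` on a boundary face. -/
def jump (u : Broken M ℝ) (F : Finset (Vec d)) (x : Vec d) : Vec d :=
  ∑ T ∈ M.cellsAt F, u T x • outerNormal T.1 F

/-- The scalar jump `⟦w⟧` of a vector function:
`w|_{T₁} · n_{T₁} + w|_{T₂} · n_{T₂}` on an interface and `w|_T · n_T` on a boundary face. -/
def jumpV (w : Broken M (Vec d)) (F : Finset (Vec d)) (x : Vec d) : ℝ :=
  ∑ T ∈ M.cellsAt F, inner ℝ (w T x) (outerNormal T.1 F)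

/-- The tensor jump `⟦w⟧_⊗` of a vector function:
`w|_{T₁} ⊗ n_{T₁} + w|_{T₂} ⊗ n_{T₂}` on an interface and `w|_T ⊗ n_T` on a boundary face. -/
def jumpT (w : Broken M (Vec d)) (F : Finset (Vec d)) (x : Vec d) : Matrix (Fin d) (Fin d) ℝ :=
  ∑ T ∈ M.cellsAt F, Matrix.vecMulVec (w T x) (outerNormal T.1 F)

/-! ### Differential operators -/

/-- The Jacobian matrix `(∇w)_{ij} = ∂_j w_i`. -/
def jacobian (w : Vec d → Vec d) (x : Vec d) : Matrix (Fin d) (Fin d) ℝ :=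
  Matrix.of fun i j => fderiv ℝ w x (EuclideanSpace.single j 1) i

/-- The divergence `div w = ∑ i, ∂_i w_i`. -/
def divergence (w : Vec d → Vec d) (x : Vec d) : ℝ := (jacobian w x).trace

/-- The row-wise divergence of `ρ v ⊗ v`: its `i`-th component is `∑ j, ∂_j (ρ v_i v_j)`. -/
def divConvection (ρ : Vec d → ℝ) (v : Vec d → Vec d) (x : Vec d) : Vec d :=
  WithLp.toLp 2 fun i => divergence (fun y => (ρ y * v y i) • v y) x

/-- The Frobenius product `A : B`. -/
def frob (A B : Matrix (Fin d) (Fin d) ℝ) : ℝ := ∑ i, ∑ j, A i j * B i j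

/-! ### Discrete spaces -/

/-- `g` is a polynomial function on `ℝ^d` of total degree at most `k`. -/
def IsPolyLE (k : ℕ) (g : Vec d → ℝ) : Prop :=
  ∃ p : MvPolynomial (Fin d) ℝ, p.totalDegree ≤ k ∧ ∀ x : Vec d, g x = MvPolynomial.eval (⇑x) p

variable (M) in
/-- `V_h`: piecewise polynomials of degree at most `k`. -/
def Vh (k : ℕ) : Set (Broken M ℝ) := {u | ∀ T, IsPolyLE k (u T)}

variable (M) in
/-- `(V_h)^d`. -/
def VhVec (k : ℕ) : Set (Broken M (Vec d)) := {w | ∀ i : Fin d, (fun T x => w T x i) ∈ Vh M k}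

variable (M) in
/-- `(V_{h,0})^d`: elements of `(V_h)^d` with zero trace on `∂Ω`. -/
def VhZero (k : ℕ) : Set (Broken M (Vec d)) :=
  {w | w ∈ VhVec M k ∧ ∀ F ∈ M.boundaryFaces, ∀ T ∈ M.cellsAt F,
    ∀ x ∈ convexHull ℝ (F : Set (Vec d)), w T x = 0}

variable (M) in
/-- `V_{h,n}`: elements of `(V_h)^d` with zero normal trace on `∂Ω`. -/
def VhNormal (k : ℕ) : Set (Broken M (Vec d)) :=
  {w | w ∈ VhVec M k ∧ ∀ F ∈ M.boundaryFaces, ∀ T ∈ M.cellsAt F,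
    ∀ x ∈ convexHull ℝ (F : Set (Vec d)), inner ℝ (w T x) (outerNormal T.1 F) = 0}

variable (M) in
/-- A six-tuple `(ρ, v, φ, μ, τ, σ)` of broken functions. -/
structure State where
  ρ : Broken M ℝ
  v : Broken M (Vec d)
  φ : Broken M ℝ
  μ : Broken M ℝ
  τ : Broken M ℝ
  σ : Broken M (Vec d)

variable (M) in
/-- The space `𝓥_h = V_h × (V_{h,0})^d × V_h × V_h × V_h × V_{h,n}`. -/
def StateSpace (k : ℕ) : Set (State M) :=
  {U | U.ρ ∈ Vh M k ∧ U.v ∈ VhZero M k ∧ U.φ ∈ Vh M k ∧ U.μ ∈ Vh M k ∧ U.τ ∈ Vh M k ∧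
    U.σ ∈ VhNormal M k}

/-! ### The model -/

/-- Data of the Navier-Stokes-Allen-Cahn model: the specific free energy `f(ρ, φ)` without its
gradient part, for densities `ρ > 0` and phase fields `φ ∈ [0, 1]`, the capillarity coefficient
`γ`, the mobility `η`, and the viscosity coefficients of the Newtonian viscous stress. -/
structure Model where
  f : ℝ → ℝ → ℝ
  f_contDiffOn : ContDiffOn ℝ 1 (fun p : ℝ × ℝ => f p.1 p.2) (Ioi 0 ×ˢ Icc 0 1)
  γ : ℝ
  γ_pos : 0 < γ
  η : ℝ
  η_pos : 0 < η
  ν : ℝ → ℝ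
  ν_continuousOn : ContinuousOn ν (Icc 0 1)
  ν_pos : ∀ s ∈ Icc (0 : ℝ) 1, 0 < ν s
  lam : ℝ → ℝ
  lam_continuousOn : ContinuousOn lam (Icc 0 1)

namespace Model

variable (D : Model)

/-- `∂(ρ f)/∂ρ (ρ, φ)`. -/
def dρ (r s : ℝ) : ℝ := deriv (fun r' => r' * D.f r' s) r

/-- `∂(ρ f)/∂φ (ρ, φ)`; one-sided at the end points of the range `[0, 1]` of `φ`. -/
def dφ (r s : ℝ) : ℝ := derivWithin (fun s' => r * D.f r s') (Icc 0 1) s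

/-- The viscous stress `S(A, φ) = ν(φ) (A + Aᵀ) + λ(φ) tr(A) I`, to be used with `A = ∇v`. -/
def stress (A : Matrix (Fin d) (Fin d) ℝ) (s : ℝ) : Matrix (Fin d) (Fin d) ℝ :=
  D.ν s • (A + A.transpose) + (D.lam s * A.trace) • (1 : Matrix (Fin d) (Fin d) ℝ)

/-- The broken stress field `S(∇w, φ)`. -/
def stressField (φ : Broken M ℝ) (w : Broken M (Vec d)) : Broken M (Matrix (Fin d) (Fin d) ℝ) :=
  fun T x => D.stress (jacobian (w T) x) (φ T x)

/-- The symmetric interior penalty form `B_h[φ; w, X]` with penalty parameter `αB`. -/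
def Bh (αB : ℝ) (φ : Broken M ℝ) (w X : Broken M (Vec d)) : ℝ :=
  domainIntegral (M := M) (fun T x => frob (D.stressField φ w T x) (jacobian (X T) x))
  - skeletonIntegral M (fun F x =>
      frob (avg (D.stressField φ w) F x) (jumpT X F x)
      + frob (avg (D.stressField φ X) F x) (jumpT w F x))
  + skeletonIntegral M (fun F x => αB / faceArea F * frob (jumpT w F x) (jumpT X F x))

/-- The discrete energy `∫_Ω ρ f(ρ, φ) + γ/2 |σ|² + ρ/2 |v|² dx`. -/
def energy (U : State M) : ℝ :=
  domainIntegral (M := M) fun T x => U.ρ T x * D.f (U.ρ T x) (U.φ T x)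
    + D.γ / 2 * ‖U.σ T x‖ ^ 2 + U.ρ T x / 2 * ‖U.v T x‖ ^ 2

end Model

/-- The square of the broken `H^1` (dG) norm on `(V_{h,0})^d`. -/
def dgNormSq (w : Broken M (Vec d)) : ℝ :=
  domainIntegral (M := M) (fun T x => frob (jacobian (w T) x) (jacobian (w T) x))
  + skeletonIntegral M (fun F x => (faceArea F)⁻¹ * frob (jumpT w F x) (jumpT w F x))

variable (M) in
/-- The penalty parameter `αB` is big enough: `B_h[φ; ·, ·]` is coercive on `(V_{h,0})^d` for every
`φ ∈ V_h` with values in `[0, 1]`. -/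
def Model.IsCoercivePenalty (D : Model) (k : ℕ) (αB : ℝ) : Prop :=
  ∀ φ ∈ Vh M k, (∀ T : M.Cell, ∀ x ∈ convexHull ℝ (T.1 : Set (Vec d)), φ T x ∈ Icc (0 : ℝ) 1) →
    ∃ c > 0, ∀ w ∈ VhZero M k, c * dgNormSq w ≤ D.Bh αB φ w w

/-! ### Numerical fluxes and the semi-discrete scheme -/

variable (M) in
/-- Numerical fluxes: they assign to a state and a test function a function on the interfaces. -/
structure Fluxes where
  F₁ : State M → Broken M ℝ → Finset (Vec d) → Vec d → ℝ
  F₂ : State M → Broken M (Vec d) → Finset (Vec d) → Vec d → ℝ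
  F₃ : State M → Broken M ℝ → Finset (Vec d) → Vec d → ℝ
  F₄ : State M → Broken M ℝ → Finset (Vec d) → Vec d → ℝ
  F₅ : State M → Broken M ℝ → Finset (Vec d) → Vec d → ℝ
  F₆ : State M → Broken M (Vec d) → Finset (Vec d) → Vec d → ℝ

variable (M) in
/-- The stabilized fluxes with parameters `α₁, α₂, α₃`. -/
def stabilizedFluxes (D : Model) (α₁ α₂ α₃ : ℝ) : Fluxes M where
  F₁ U ψ F x :=
    - (jumpV (fun T y => U.ρ T y • U.v T y) F x * avg ψ F x)
    + α₁ * inner ℝ (jump U.τ F x) (jump ψ F x)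
  F₂ U X F x :=
    - inner ℝ (jump U.τ F x) (avg (fun T y => U.ρ T y • X T y) F x)
    + inner ℝ (jump U.φ F x) (avg (fun T y => U.μ T y • X T y) F x)
    + α₂ * (jumpV U.v F x * jumpV X F x)
  F₃ U Θ F x :=
    - inner ℝ (jump U.φ F x) (avg (fun T y => Θ T y • U.v T y) F x)
    + α₃ * inner ℝ (jump U.μ F x) (jump Θ F x)
  F₄ U χ F x := - (D.γ * (jumpV U.σ F x * avg χ F x))
  F₅ _ _ _ _ := 0
  F₆ U Z F x := inner ℝ (jump U.φ F x) (avg Z F x)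

/-- `U : [0, t₁] → 𝓥_h` is a general spatially semi-discrete dG approximation on `[0, t₁]`, of
polynomial degree `k`, with numerical fluxes `Fl` and penalty parameter `αB`. Continuity and
differentiability in time of a curve in the finite-dimensional space of piecewise polynomials are
expressed through its point values. The traces of `ρ` on the closed cells are positive, i.e. `1/ρ`
is bounded; no initial value is prescribed. -/
structure IsSemiDiscrete (D : Model) (k : ℕ) (αB : ℝ) (Fl : Fluxes M) (t₁ : ℝ)
    (U : ℝ → State M) : Prop where
  mem : ∀ t ∈ Icc 0 t₁, U t ∈ StateSpace M k
  cont_ρ : ∀ T x, ContinuousOn (fun t => (U t).ρ T x) (Icc 0 t₁)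
  cont_v : ∀ T x, ContinuousOn (fun t => (U t).v T x) (Icc 0 t₁)
  cont_φ : ∀ T x, ContinuousOn (fun t => (U t).φ T x) (Icc 0 t₁)
  cont_μ : ∀ T x, ContinuousOn (fun t => (U t).μ T x) (Icc 0 t₁)
  cont_τ : ∀ T x, ContinuousOn (fun t => (U t).τ T x) (Icc 0 t₁)
  cont_σ : ∀ T x, ContinuousOn (fun t => (U t).σ T x) (Icc 0 t₁)
  diff_ρ : ∀ T x, DifferentiableOn ℝ (fun t => (U t).ρ T x) (Icc 0 t₁)
  diff_v : ∀ T x, DifferentiableOn ℝ (fun t => (U t).v T x) (Icc 0 t₁)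
  diff_φ : ∀ T x, DifferentiableOn ℝ (fun t => (U t).φ T x) (Icc 0 t₁)
  diff_σ : ∀ T x, DifferentiableOn ℝ (fun t => (U t).σ T x) (Icc 0 t₁)
  ρ_pos : ∀ t ∈ Icc 0 t₁, ∀ T : M.Cell, ∀ x ∈ convexHull ℝ (T.1 : Set (Vec d)),
    0 < (U t).ρ T x
  φ_mem : ∀ t ∈ Icc 0 t₁, ∀ T : M.Cell, ∀ x ∈ convexHull ℝ (T.1 : Set (Vec d)),
    (U t).φ T x ∈ Icc (0 : ℝ) 1
  mass : ∀ t ∈ Ioo 0 t₁, ∀ ψ ∈ Vh M k,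
    0 = domainIntegral (M := M) (fun T x =>
          (deriv (fun s => (U s).ρ T x) t
            + divergence (fun y => (U t).ρ T y • (U t).v T y) x) * ψ T x)
        + interfaceIntegral M (Fl.F₁ (U t) ψ)
  momentum : ∀ t ∈ Ioo 0 t₁, ∀ X ∈ VhZero M k,
    0 = domainIntegral (M := M) (fun T x =>
          inner ℝ
            ((U t).ρ T x • deriv (fun s => (U s).v T x) t
              + divConvection ((U t).ρ T) ((U t).v T) x
              - divergence (fun y => (U t).ρ T y • (U t).v T y) x • (U t).v T x
              + (U t).ρ T x • ∇ ((U t).τ T) x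
              - (U t).μ T x • ∇ ((U t).φ T) x
              - ((1 / 2 : ℝ) * (U t).ρ T x) • ∇ (fun y => ‖(U t).v T y‖ ^ 2) x)
            (X T x))
        + interfaceIntegral M (Fl.F₂ (U t) X)
        + D.Bh αB (U t).φ (U t).v X
  phase : ∀ t ∈ Ioo 0 t₁, ∀ Θ ∈ Vh M k,
    0 = domainIntegral (M := M) (fun T x =>
          (deriv (fun s => (U s).φ T x) t
            + inner ℝ ((U t).v T x) (∇ ((U t).φ T) x)
            + D.η * ((U t).μ T x / (U t).ρ T x)) * Θ T x)
        + interfaceIntegral M (Fl.F₃ (U t) Θ)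
  potential_μ : ∀ t ∈ Ioo 0 t₁, ∀ χ ∈ Vh M k,
    0 = domainIntegral (M := M) (fun T x =>
          ((U t).μ T x - D.dφ ((U t).ρ T x) ((U t).φ T x)
            + D.γ * divergence ((U t).σ T) x) * χ T x)
        + interfaceIntegral M (Fl.F₄ (U t) χ)
  potential_τ : ∀ t ∈ Ioo 0 t₁, ∀ ζ ∈ Vh M k,
    0 = domainIntegral (M := M) (fun T x =>
          ((U t).τ T x - D.dρ ((U t).ρ T x) ((U t).φ T x)
            - 1 / 2 * ‖(U t).v T x‖ ^ 2) * ζ T x)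
        + interfaceIntegral M (Fl.F₅ (U t) ζ)
  gradient_σ : ∀ t ∈ Ioo 0 t₁, ∀ Z ∈ VhNormal M k,
    0 = domainIntegral (M := M) (fun T x => inner ℝ ((U t).σ T x - ∇ ((U t).φ T) x) (Z T x))
        + interfaceIntegral M (Fl.F₆ (U t) Z)

end

end NSAC

/-! The dissipation identity comes from testing each equation with the right discrete function: the
mass balance with `τ`, the momentum balance with `v`, the phase equation with `μ`, the equations for
`μ` and `τ` with the time derivatives of `φ` and `ρ`, and the time derivative of the equation for
`σ` with `σ` itself. By the chain rule the rate of the energy density is a combination of the tested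
integrands, the dissipation `η μ² / ρ`, and two exact divergences, `div (τ ρ v)` and `γ div (∂ₜφ
σ)`. The convective terms drop out by the kinetic energy balance `inner_divConvection`.

The divergences become interface integrals by `domainIntegral_divergence_smul`. Boundary faces
contribute nothing, because `v` has zero trace and `σ` zero normal trace there. On an interface the
product rule for jumps and averages produces exactly the consistent parts of the fluxes. These
cancel, so that only the penalties with `α₁, α₂, α₃` and the form `B_h` survive. The sign follows
from coercivity and from the positivity of `ρ`.

Three ingredients need work. The divergence theorem on a simplex (`integral_divergence_cell`)
follows from the fundamental theorem of calculus along edges, as the edges at one vertex span the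
space. Conformity has to yield that an interface has exactly two cells, with opposite normals
(`cellsAt_interface`), and that every other facet lies in `∂Ω`
(`mem_boundaryFaces_of_notMem_interfaces`).

The third ingredient is differentiation in time. Since `V_h` is finite-dimensional, pointwise
differentiability gives a derivative in `V_h` that commutes with linear functionals
(`hasDerivAt_of_pointwise`). The nonlinear energy is differentiated under the integral sign
(`IsSemiDiscrete.hasDerivAt_energy`), using that its density is Lipschitz on a compact convex set of
states. -/

namespace NSAC

noncomputable section

open Set MeasureTheory
open scoped Gradient

/-! ### Hausdorff and Lebesgue measure in affine parametrizations -/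

section Measure

variable {m n : ℕ}

/-- The restriction of the `m`-dimensional Hausdorff measure to an affine image. -/
theorem euclideanHausdorffMeasure_restrict_affine_image (L : Vec m →ₗ[ℝ] Vec n) (a : Vec n)
    (s : Set (Vec m)) :
    (Measure.euclideanHausdorffMeasure m : Measure (Vec n)).restrict ((fun y => a + L y) '' s) =
      ENNReal.ofReal L.normDet • (volume.restrict s).map (fun y => a + L y) := by
  have hm : Measurable fun y => a + L y :=
    (continuous_const.add L.continuous_of_finiteDimensional).measurable
  ext t ht
  have himg : t ∩ (fun y => a + L y) '' s =
      (fun x => a + x) '' (L '' ((fun y => a + L y) ⁻¹' t ∩ s)) := by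
    rw [image_image, inter_comm ((fun y => a + L y) ⁻¹' t), image_inter_preimage, inter_comm]
  rw [Measure.restrict_apply ht, himg,
    (isometry_add_left a).euclideanHausdorffMeasure_image, Measure.smul_apply,
    Measure.map_apply hm ht, Measure.restrict_apply (hm ht), smul_eq_mul]
  have := L.euclideanHausdorffMeasure_image_eq_normDet_mul_volume
    ((fun y => a + L y) ⁻¹' t ∩ s)
  rwa [finrank_euclideanSpace_fin] at this

/-- Slicing Lebesgue measure by the hyperplanes orthogonal to `ν`: every slice is a translate of an
`L`-image, on which Hausdorff measure is `normDet` times Lebesgue measure in the parameters. -/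
theorem volume_eq_smul_map_orthogonal (L : Vec m →ₗ[ℝ] Vec (m + 1)) (ν : Vec (m + 1))
    (hν : ‖ν‖ = 1) (hL : L.range = (ℝ ∙ ν)ᗮ) :
    (volume : Measure (Vec (m + 1))) = ENNReal.ofReal L.normDet •
      ((volume : Measure ℝ).prod (volume : Measure (Vec m))).map
        (fun p => L p.2 + p.1 • ν) := by
  have hLc : Continuous L := L.continuous_of_finiteDimensional
  have hm : Measurable fun p : ℝ × Vec m => L p.2 + p.1 • ν := by fun_prop
  ext t ht
  have hν0 : ν ≠ 0 := by intro h; simp [h] at hν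
  have h := EuclideanGeometry.euclideanHausdorffMeasure_eq_lintegral (0 : Vec (m + 1)) hν0 ht
  rw [InnerProductSpace.euclideanHausdorffMeasure_eq_volume, finrank_euclideanSpace_fin] at h
  rw [h, Measure.smul_apply, Measure.map_apply hm ht, Measure.prod_apply (hm ht), smul_eq_mul,
    ← lintegral_const_mul' _ _ ENNReal.ofReal_ne_top]
  have hν1 : ‖ν‖ₑ = 1 := by rw [enorm_eq_nnnorm, show ‖ν‖₊ = 1 from NNReal.eq hν]; simp
  rw [hν1, one_mul]
  refine lintegral_congr fun x => ?_
  have himg : t ∩ (AffineSubspace.mk' (x • ν +ᵥ (0 : Vec (m + 1))) (ℝ ∙ ν)ᗮ : Set (Vec (m + 1))) =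
      (fun z => x • ν + z) '' (L '' (Prod.mk x ⁻¹' ((fun p : ℝ × Vec m => L p.2 + p.1 • ν) ⁻¹' t))) := by
    ext z
    simp only [mem_inter_iff, SetLike.mem_coe, AffineSubspace.mem_mk', ← hL, LinearMap.mem_range,
      image_image, mem_image, mem_preimage, vsub_eq_sub, vadd_eq_add, add_zero]
    constructor
    · rintro ⟨hz, y, hy⟩
      have : x • ν + L y = z := by rw [hy]; abel
      exact ⟨y, by rwa [add_comm (L y), this], this⟩
    · rintro ⟨y, hy, rfl⟩
      exact ⟨by rwa [add_comm (x • ν)], y, by abel⟩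
  rw [himg, (isometry_add_left _).euclideanHausdorffMeasure_image]
  have := L.euclideanHausdorffMeasure_image_eq_normDet_mul_volume
    (Prod.mk x ⁻¹' ((fun p : ℝ × Vec m => L p.2 + p.1 • ν) ⁻¹' t))
  rwa [finrank_euclideanSpace_fin] at this

/-- Lebesgue measure in the coordinates given by a parametrization `L` of a hyperplane with unit
normal `ν` and a direction `e` transversal to it. -/
theorem volume_eq_smul_map_transversal (L : Vec m →ₗ[ℝ] Vec (m + 1)) (ν e a : Vec (m + 1))
    (hν : ‖ν‖ = 1) (hL : L.range = (ℝ ∙ ν)ᗮ) (he : inner ℝ ν e ≠ 0) :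
    (volume : Measure (Vec (m + 1))) = ENNReal.ofReal (L.normDet * |inner ℝ ν e|) •
      ((volume : Measure ℝ).prod (volume : Measure (Vec m))).map
        (fun p => a + L p.2 + p.1 • e) := by
  have hLc : Continuous L := L.continuous_of_finiteDimensional
  set h : ℝ := inner ℝ ν e with hh
  -- The tangential part of `e` in the coordinates of `L`. The shear `(t, y) ↦ (h t, y + t w)` then
  -- turns the normal direction into `e`, because `L (y + t w) + h t ν = L y + t e`.
  obtain ⟨w, hw⟩ : ∃ w, L w = e - h • ν := by
    rw [← LinearMap.mem_range, hL, Submodule.mem_orthogonal_singleton_iff_inner_right,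
      inner_sub_right, inner_smul_right, real_inner_self_eq_norm_sq, hν]
    simp [hh]
  have hc : (volume : Measure ℝ) = ENNReal.ofReal |h| • (volume : Measure ℝ).map (h * ·) := by
    rw [Real.map_volume_mul_left he, smul_smul, ← ENNReal.ofReal_mul (abs_nonneg _), ← abs_mul,
      mul_inv_cancel₀ he]
    simp
  have hsk : MeasurePreserving (fun p : ℝ × Vec m => (h * p.1, p.2 + p.1 • w))
      ((volume : Measure ℝ).prod (volume : Measure (Vec m)))
      (((volume : Measure ℝ).map (h * ·)).prod (volume : Measure (Vec m))) := by
    refine MeasurePreserving.skew_product (f := fun x => h * x) (g := fun x y => y + x • w)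
      ⟨by fun_prop, rfl⟩ (by fun_prop) (Filter.Eventually.of_forall fun x => ?_)
    exact (measurePreserving_add_right volume (x • w)).map_eq
  have h1 : (volume : Measure (Vec (m + 1))) = ENNReal.ofReal (L.normDet * |h|) •
      ((volume : Measure ℝ).prod (volume : Measure (Vec m))).map
        (fun p => L p.2 + p.1 • e) := by
    conv_lhs => rw [volume_eq_smul_map_orthogonal L ν hν hL, hc]
    rw [Measure.prod_smul_left, Measure.map_smul, smul_smul,
      ← ENNReal.ofReal_mul L.normDet_nonneg, ← hsk.map_eq, Measure.map_map (by fun_prop)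
        hsk.measurable]
    congr 2
    ext1 p
    simp only [Function.comp, map_add, map_smul, hw, smul_sub, smul_smul]
    rw [mul_comm h]
    abel
  rw [← (measurePreserving_add_left volume a).map_eq]
  conv_lhs => rw [h1]
  rw [Measure.map_smul, Measure.map_map (by fun_prop) (by fun_prop)]
  congr 2
  ext1 p
  simp only [Function.comp, add_assoc]

end Measure

/-! ### The outer unit normal -/

section Normal

variable {d : ℕ}

theorem centroid_eq_smul_sum {F : Finset (Vec d)} (hF : F.Nonempty) :
    F.centroid ℝ id = (F.card : ℝ)⁻¹ • ∑ x ∈ F, x := by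
  rw [Finset.centroid_def, Finset.affineCombination_eq_linear_combination _ _ _
    (Finset.sum_centroidWeights_eq_one_of_nonempty ℝ F hF)]
  simp [Finset.centroidWeights, Finset.smul_sum]

/-- `outerNormal` is defined by the barycentres of the cell and the facet. This relation replaces
them by the opposite vertex `q`, from which the sign of the normal can be read off. -/
theorem smul_centroid_sub_centroid [DecidableEq (Vec d)] {T : Finset (Vec d)} {q : Vec d}
    (hq : q ∈ T) (hF : (T.erase q).Nonempty) :
    (T.card : ℝ) • ((T.erase q).centroid ℝ id - T.centroid ℝ id) =
      (T.erase q).centroid ℝ id - q := by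
  have hc : ((T.erase q).card : ℝ) + 1 = T.card := by
    exact_mod_cast Finset.card_erase_add_one hq
  have h0 : ((T.erase q).card : ℝ) ≠ 0 := by simpa using hF.ne_empty
  have h1 : (T.card : ℝ) ≠ 0 := by simpa using (Finset.ne_empty_of_mem hq)
  rw [smul_sub, centroid_eq_smul_sum hF, centroid_eq_smul_sum ⟨q, hq⟩, smul_smul (T.card : ℝ),
    smul_smul (T.card : ℝ), mul_inv_cancel₀ h1, one_smul, ← Finset.sum_erase_add T _ hq, ← hc,
    add_mul, mul_inv_cancel₀ h0, add_smul, one_mul, one_smul]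
  abel

theorem erase_vsub_mem_vectorSpan [DecidableEq (Vec d)] {T : Finset (Vec d)} {q p : Vec d}
    (hp : p ∈ T.erase q) :
    (T.erase q).centroid ℝ id - p ∈ vectorSpan ℝ ((T.erase q : Finset (Vec d)) : Set (Vec d)) := by
  have h := convexHull_subset_affineSpan (𝕜 := ℝ) _
    ((T.erase q).centroid_mem_convexHull (R := ℝ) ⟨p, hp⟩)
  rw [← direction_affineSpan]
  exact AffineSubspace.vsub_mem_direction h (subset_affineSpan _ _ (Finset.mem_coe.2 hp))

variable [DecidableEq (Vec d)] {T : Finset (Vec d)} {q : Vec d}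

/-- The characteristic properties of the outer unit normal. -/
theorem outerNormal_spec (hT : AffineIndependent ℝ ((↑) : {x // x ∈ T} → Vec d)) (hq : q ∈ T)
    (hF : (T.erase q).Nonempty) :
    ‖outerNormal T (T.erase q)‖ = 1 ∧
    outerNormal T (T.erase q) ∈
      (vectorSpan ℝ ((T.erase q : Finset (Vec d)) : Set (Vec d)))ᗮ ∧
    ∀ p ∈ T.erase q, inner ℝ (outerNormal T (T.erase q)) (q - p) < 0 := by
  set W := vectorSpan ℝ ((T.erase q : Finset (Vec d)) : Set (Vec d)) with hW
  set c := (T.erase q).centroid ℝ id with hc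
  set b := c - T.centroid ℝ id with hb
  set w : Vec d := Wᗮ.starProjection b with hw
  have hN : outerNormal T (T.erase q) = ‖w‖⁻¹ • w := rfl
  have hwW : w ∈ Wᗮ := Submodule.starProjection_apply_mem _ _
  have h1 : (0 : ℝ) < T.card := by exact_mod_cast Finset.card_pos.2 ⟨q, hq⟩
  have hcq : (T.card : ℝ) • b = c - q := smul_centroid_sub_centroid hq hF
  have hqF : q ∉ affineSpan ℝ ((T.erase q : Finset (Vec d)) : Set (Vec d)) := by
    have := hT.notMem_affineSpan_sdiff ⟨q, hq⟩ univ
    convert this using 3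
    ext x; simp [and_comm]
  -- Otherwise `q - c` would be a direction of the facet and `q` would lie in its affine span,
  -- against affine independence.
  have hbW : b ∉ W := by
    intro h
    have h2 : q - c ∈ W := by
      rw [← neg_sub c q, ← hcq]; exact W.neg_mem (W.smul_mem _ h)
    rw [hW, ← direction_affineSpan] at h2
    have hcm := convexHull_subset_affineSpan (𝕜 := ℝ) _
      ((T.erase q).centroid_mem_convexHull (R := ℝ) hF)
    exact hqF ((AffineSubspace.vsub_right_mem_direction_iff_mem hcm q).1 h2)
  have hw0 : w ≠ 0 := by
    intro h
    apply hbW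
    have : b = W.starProjection b := by
      have := W.starProjection_add_starProjection_orthogonal b
      rw [← hw, h, add_zero] at this
      exact this.symm
    rw [this]
    exact Submodule.starProjection_apply_mem _ _
  have hwn : 0 < ‖w‖ := norm_pos_iff.2 hw0
  refine ⟨?_, ?_, fun p hp => ?_⟩
  · rw [hN, norm_smul, norm_inv, norm_norm, inv_mul_cancel₀ hwn.ne']
  · rw [hN]; exact Submodule.smul_mem _ _ hwW
  -- As `w` is the orthogonal projection of `b`, `⟨w, b⟩ = ‖w‖²`. Modulo directions of the facet, `q
  -- - p` equals `-(card T) b`, which gives the sign.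
  · have h2 : inner ℝ w b = ‖w‖ ^ 2 := by
      have h5 : Wᗮ.starProjection w = w := Submodule.starProjection_eq_self_iff.2 hwW
      rw [← real_inner_self_eq_norm_sq]
      conv_lhs => rw [← h5, Submodule.inner_starProjection_left_eq_right, ← hw]
    have h3 : inner ℝ w (c - p) = 0 :=
      Submodule.inner_left_of_mem_orthogonal (erase_vsub_mem_vectorSpan hp) hwW
    have h4 : q - p = (c - p) - (T.card : ℝ) • b := by rw [hcq]; abel
    rw [hN, inner_smul_left, h4, inner_sub_right, h3, inner_smul_right, h2]
    simp only [conj_trivial, zero_sub, mul_neg, neg_neg_iff_pos]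
    positivity

theorem norm_outerNormal (hT : AffineIndependent ℝ ((↑) : {x // x ∈ T} → Vec d)) (hq : q ∈ T)
    (hF : (T.erase q).Nonempty) : ‖outerNormal T (T.erase q)‖ = 1 :=
  (outerNormal_spec hT hq hF).1

theorem inner_outerNormal_neg (hT : AffineIndependent ℝ ((↑) : {x // x ∈ T} → Vec d)) (hq : q ∈ T)
    {p : Vec d} (hp : p ∈ T.erase q) : inner ℝ (outerNormal T (T.erase q)) (q - p) < 0 :=
  (outerNormal_spec hT hq ⟨p, hp⟩).2.2 p hp

theorem inner_outerNormal_eq_zero (hT : AffineIndependent ℝ ((↑) : {x // x ∈ T} → Vec d))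
    (hq : q ∈ T) {p r : Vec d} (hp : p ∈ T.erase q) (hr : r ∈ T.erase q) :
    inner ℝ (outerNormal T (T.erase q)) (r - p) = 0 :=
  Submodule.inner_left_of_mem_orthogonal
    (vsub_mem_vectorSpan ℝ (Finset.mem_coe.2 hr) (Finset.mem_coe.2 hp))
    (outerNormal_spec hT hq ⟨p, hp⟩).2.1

/-- The direction of a facet is the orthogonal complement of its normal. -/
theorem vectorSpan_erase_eq (hT : AffineIndependent ℝ ((↑) : {x // x ∈ T} → Vec d)) (hq : q ∈ T)
    (hcard : T.card = d + 1) (hF : (T.erase q).Nonempty) :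
    vectorSpan ℝ ((T.erase q : Finset (Vec d)) : Set (Vec d)) =
      (ℝ ∙ outerNormal T (T.erase q))ᗮ := by
  obtain ⟨hn, hW, -⟩ := outerNormal_spec hT hq hF
  have hc : (T.erase q).card = d := by rw [Finset.card_erase_of_mem hq, hcard]; rfl
  obtain ⟨m, rfl⟩ : ∃ m, d = m + 1 := Nat.exists_eq_succ_of_ne_zero (by
    rintro rfl; exact hF.ne_empty (Finset.card_eq_zero.1 hc))
  have : Fact (Module.finrank ℝ (Vec (m + 1)) = m + 1) := ⟨finrank_euclideanSpace_fin⟩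
  -- One inclusion is orthogonality; both spaces have dimension `m`.
  refine Submodule.eq_of_le_of_finrank_eq (fun x hx => ?_) ?_
  · rw [Submodule.mem_orthogonal_singleton_iff_inner_right]
    exact Submodule.inner_left_of_mem_orthogonal hx hW
  · rw [Submodule.finrank_orthogonal_span_singleton (n := m) (by intro h; simp [h] at hn)]
    have hi : AffineIndependent ℝ ((↑) : {x // x ∈ T.erase q} → Vec (m + 1)) :=
      hT.mono (s := ((T.erase q : Finset (Vec (m + 1))) : Set (Vec (m + 1))))
        (t := (T : Set (Vec (m + 1)))) (Finset.coe_subset.2 (T.erase_subset q))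
    have := hi.finrank_vectorSpan (n := m) (by simp only [Fintype.card_coe, hc])
    rwa [Subtype.range_coe_subtype] at this

end Normal

/-! ### Parametrization of simplices and the divergence theorem -/

section Param

variable {m n : ℕ}

/-- The corner simplex `{y | 0 ≤ y, ∑ y ≤ 1}`. -/
def corner (m : ℕ) : Set (Vec m) := {y | (∀ j, 0 ≤ y j) ∧ ∑ j, y j ≤ 1}

/-- The corner simplex of `ℝ × ℝ^m`. -/
def prodCorner (m : ℕ) : Set (ℝ × Vec m) :=
  {z | 0 ≤ z.1 ∧ (∀ j, 0 ≤ z.2 j) ∧ z.1 + ∑ j, z.2 j ≤ 1}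

/-- The linear map sending the `j`-th basis vector to `r j - p`. -/
def edgeMap (p : Vec n) (r : Fin m → Vec n) : Vec m →ₗ[ℝ] Vec n :=
  Fintype.linearCombination ℝ (fun j => r j - p) ∘ₗ
    (WithLp.linearEquiv 2 ℝ (Fin m → ℝ)).toLinearMap

theorem edgeMap_apply (p : Vec n) (r : Fin m → Vec n) (y : Vec m) :
    edgeMap p r y = ∑ j, y j • (r j - p) := by
  simp [edgeMap, Fintype.linearCombination_apply]

/-- Links the parametrization of a facet to `vectorSpan_erase_eq`, so that its range is recognized
as the hyperplane orthogonal to the normal. -/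
theorem range_edgeMap (p : Vec n) (r : Fin m → Vec n) :
    (edgeMap p r).range = vectorSpan ℝ (insert p (range r)) := by
  rw [edgeMap, LinearMap.range_comp, LinearEquiv.range, Submodule.map_top,
    Fintype.range_linearCombination, vectorSpan_eq_span_vsub_set_right ℝ (mem_insert p _),
    image_insert_eq, ← range_comp]
  simp [Function.comp_def, Submodule.span_insert_zero]

theorem isClosed_corner : IsClosed (corner m) := by
  have h : corner m = (⋂ j, {y | 0 ≤ y j}) ∩ {y | ∑ j, y j ≤ 1} := by
    ext y; simp [corner]
  rw [h]
  exact (isClosed_iInter fun j => isClosed_le (by fun_prop) (by fun_prop)).inter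
    (isClosed_le (by fun_prop) (by fun_prop))

theorem isClosed_prodCorner : IsClosed (prodCorner m) := by
  have h : prodCorner m = {z | 0 ≤ z.1} ∩ ((⋂ j, {z | 0 ≤ z.2 j}) ∩
      {z | z.1 + ∑ j, z.2 j ≤ 1}) := by
    ext y; simp [prodCorner]
  rw [h]
  exact (isClosed_le (by fun_prop) (by fun_prop)).inter
    ((isClosed_iInter fun j => isClosed_le (by fun_prop) (by fun_prop)).inter
    (isClosed_le (by fun_prop) (by fun_prop)))

theorem isBounded_corner : Bornology.IsBounded (corner m) := by
  refine isBounded_iff_forall_norm_le.2 ⟨√(∑ _ : Fin m, 1), fun y hy => ?_⟩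
  rw [EuclideanSpace.norm_eq]
  refine Real.sqrt_le_sqrt (Finset.sum_le_sum fun j _ => ?_)
  have h1 : y j ≤ 1 :=
    (Finset.single_le_sum (f := fun j => y j) (fun i _ => hy.1 i) (Finset.mem_univ j)).trans hy.2
  rw [Real.norm_of_nonneg (hy.1 j)]
  exact pow_le_one₀ (hy.1 j) h1

theorem isCompact_corner : IsCompact (corner m) :=
  Metric.isCompact_of_isClosed_isBounded isClosed_corner isBounded_corner

theorem isCompact_prodCorner : IsCompact (prodCorner m) := by
  refine (isCompact_Icc.prod isCompact_corner).of_isClosed_subset isClosed_prodCorner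
    (s := Icc (0 : ℝ) 1 ×ˢ corner m) ?_
  rintro ⟨s, y⟩ ⟨h1, h2, h3⟩
  have h4 : 0 ≤ ∑ j, y j := Finset.sum_nonneg fun j _ => h2 j
  simp only at h1 h3
  exact ⟨⟨h1, by simp only; linarith⟩, h2, by simp only; linarith⟩

theorem convex_corner : Convex ℝ (corner m) := by
  intro x hx y hy a b ha hb hab
  refine ⟨fun j => ?_, ?_⟩
  · have := hx.1 j; have := hy.1 j
    simp only [PiLp.add_apply, PiLp.smul_apply, smul_eq_mul]; positivity
  · simp only [PiLp.add_apply, PiLp.smul_apply, smul_eq_mul, Finset.sum_add_distrib,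
      ← Finset.mul_sum]
    calc _ ≤ a * 1 + b * 1 := by gcongr <;> [exact hx.2; exact hy.2]
      _ = 1 := by linarith

theorem convex_prodCorner : Convex ℝ (prodCorner m) := by
  intro x hx y hy a b ha hb hab
  refine ⟨?_, fun j => ?_, ?_⟩
  · have := hx.1; have := hy.1
    simp only [Prod.fst_add, Prod.smul_fst, smul_eq_mul]; positivity
  · have := hx.2.1 j; have := hy.2.1 j
    simp only [Prod.snd_add, Prod.smul_snd, PiLp.add_apply, PiLp.smul_apply, smul_eq_mul]
    positivity
  · simp only [Prod.fst_add, Prod.smul_fst, Prod.snd_add, Prod.smul_snd, PiLp.add_apply,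
      PiLp.smul_apply, smul_eq_mul, Finset.sum_add_distrib, ← Finset.mul_sum]
    calc _ = a * (x.1 + ∑ j, x.2 j) + b * (y.1 + ∑ j, y.2 j) := by ring
      _ ≤ a * 1 + b * 1 := by gcongr <;> [exact hx.2.2; exact hy.2.2]
      _ = 1 := by linarith

/-- The point with parameter `y` has barycentric coordinates `1 - ∑ y` at `p` and `y j` at `r j`. -/
theorem convexHull_eq_image_corner (p : Vec n) (r : Fin m → Vec n) :
    convexHull ℝ (insert p (range r)) = (fun y => p + edgeMap p r y) '' corner m := by
  apply Subset.antisymm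
  · refine convexHull_min ?_ ?_
    · rintro x (rfl | ⟨j, rfl⟩)
      · exact ⟨0, ⟨by simp, by simp⟩, by simp⟩
      · refine ⟨EuclideanSpace.single j 1, ⟨fun i => ?_, ?_⟩, ?_⟩
        · simp only [PiLp.single_apply]; split_ifs <;> simp
        · simp
        · simp [edgeMap_apply]
    · rw [← image_image (fun x => p + x) (edgeMap p r)]
      exact (convex_corner.linear_image _).translate p
  · rintro _ ⟨y, hy, rfl⟩
    have h : p + edgeMap p r y = (1 - ∑ j, y j) • p + ∑ j, y j • r j := by
      rw [edgeMap_apply]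
      simp only [smul_sub, Finset.sum_sub_distrib, sub_smul, one_smul, ← Finset.sum_smul]
      abel
    have := (convex_convexHull ℝ (insert p (range r))).sum_mem (t := Finset.univ)
      (w := fun o : Option (Fin m) => o.elim (1 - ∑ j, y j) fun j => y j)
      (z := fun o => o.elim p r)
      (by rintro (_ | j) -; exacts [sub_nonneg.2 hy.2, hy.1 j])
      (by simp [Fintype.sum_option])
      (by rintro (_ | j) -
          exacts [subset_convexHull _ _ (mem_insert _ _),
            subset_convexHull _ _ (mem_insert_of_mem _ (mem_range_self j))])
    simpa [Fintype.sum_option, h] using this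

/-- The vertex `q` gets a separate coordinate, so that the edge from `p` to `q` becomes a coordinate
axis for Fubini's theorem. -/
theorem convexHull_eq_image_prodCorner (p q : Vec n) (r : Fin m → Vec n) :
    convexHull ℝ (insert q (insert p (range r))) =
      (fun z : ℝ × Vec m => p + edgeMap p r z.2 + z.1 • (q - p)) '' prodCorner m := by
  apply Subset.antisymm
  · refine convexHull_min ?_ ?_
    · rintro x (rfl | rfl | ⟨j, rfl⟩)
      · exact ⟨(1, 0), ⟨by simp, by simp, by simp⟩, by simp⟩
      · exact ⟨0, ⟨by simp, by simp, by simp⟩, by simp⟩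
      · refine ⟨(0, EuclideanSpace.single j 1), ⟨by simp, fun i => ?_, ?_⟩, ?_⟩
        · simp only [PiLp.single_apply]; split_ifs <;> simp
        · simp
        · simp [edgeMap_apply]
    · have h : (fun z : ℝ × Vec m => p + edgeMap p r z.2 + z.1 • (q - p)) =
          fun z => p + ((edgeMap p r).coprod (LinearMap.toSpanSingleton ℝ _ (q - p)) ∘ₗ
            (LinearEquiv.prodComm ℝ ℝ (Vec m)).toLinearMap) z := by
        ext1 z; simp [add_assoc]
      rw [h, ← image_image (fun x => p + x)]
      exact (convex_prodCorner.linear_image _).translate p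
  · rintro _ ⟨⟨s, y⟩, ⟨h1, h2, h3⟩, rfl⟩
    have h : p + edgeMap p r y + s • (q - p) =
        (1 - (s + ∑ j, y j)) • p + (∑ j, y j • r j + s • q) := by
      rw [edgeMap_apply]
      simp only [smul_sub, Finset.sum_sub_distrib, sub_smul, add_smul, one_smul, ← Finset.sum_smul]
      abel
    set S : Set (Vec n) := insert q (insert p (range r)) with hS
    have := (convex_convexHull ℝ S).sum_mem (t := Finset.univ)
      (w := fun o : Option (Option (Fin m)) =>
        o.elim (1 - (s + ∑ j, y j)) fun o => o.elim s fun j => y j)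
      (z := fun o => o.elim p fun o => o.elim q r)
      (by rintro (_ | _ | j) -; exacts [sub_nonneg.2 h3, h1, h2 j])
      (by simp [Fintype.sum_option])
      (by rintro (_ | _ | j) -
          exacts [subset_convexHull _ _ (by simp [hS]), subset_convexHull _ _ (by simp [hS]),
            subset_convexHull _ _ (by simp [hS])])
    simp only [Fintype.sum_option, Option.elim] at this
    change p + edgeMap p r y + s • (q - p) ∈ convexHull ℝ S
    rw [h, add_comm (∑ j, y j • r j)]
    exact this

end Param

/-! ### Integrals over faces and cells in corner coordinates -/

section Integrals

variable {m : ℕ}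

/-- The restriction of the surface measure to a face is finite. -/
theorem euclideanHausdorffMeasure_convexHull_lt_top {n : ℕ} (p : Vec n) (r : Fin m → Vec n) :
    (Measure.euclideanHausdorffMeasure m : Measure (Vec n)) (convexHull ℝ (insert p (range r)))
      < ⊤ := by
  rw [convexHull_eq_image_corner, ← image_image (fun x => p + x) (edgeMap p r),
    (isometry_add_left p).euclideanHausdorffMeasure_image]
  have := (edgeMap p r).euclideanHausdorffMeasure_image_eq_normDet_mul_volume (corner m)
  rw [finrank_euclideanSpace_fin] at this
  rw [this]
  exact ENNReal.mul_lt_top ENNReal.ofReal_lt_top isCompact_corner.measure_lt_top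

theorem integral_face {n : ℕ} (p : Vec n) (r : Fin m → Vec n) {g : Vec n → ℝ} (hg : Continuous g) :
    ∫ x in convexHull ℝ (insert p (range r)), g x ∂(Measure.euclideanHausdorffMeasure m) =
      (edgeMap p r).normDet * ∫ y in corner m, g (p + edgeMap p r y) := by
  have hL : Continuous (edgeMap p r) := (edgeMap p r).continuous_of_finiteDimensional
  rw [convexHull_eq_image_corner, euclideanHausdorffMeasure_restrict_affine_image,
    integral_smul_measure, ENNReal.toReal_ofReal (LinearMap.normDet_nonneg _),
    integral_map (by fun_prop) hg.aestronglyMeasurable, smul_eq_mul]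

/-- The Jacobian of the affine parametrization is base times height: `normDet` measures the facet
opposite `q`, and `|⟨ν, q - p⟩|` is the distance of `q` from it. -/
theorem integral_cell (p q : Vec (m + 1)) (r : Fin m → Vec (m + 1)) {ν : Vec (m + 1)}
    (hν : ‖ν‖ = 1) (hL : (edgeMap p r).range = (ℝ ∙ ν)ᗮ) (he : inner ℝ ν (q - p) ≠ 0)
    {g : Vec (m + 1) → ℝ} (hg : Continuous g) :
    ∫ x in convexHull ℝ (insert q (insert p (range r))), g x =
      (edgeMap p r).normDet * |inner ℝ ν (q - p)| *
        ∫ z in prodCorner m, g (p + edgeMap p r z.2 + z.1 • (q - p)) := by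
  have hLc : Continuous (edgeMap p r) := (edgeMap p r).continuous_of_finiteDimensional
  have hfin : Fact (Module.finrank ℝ (Vec (m + 1)) = m + 1) := ⟨finrank_euclideanSpace_fin⟩
  have hinj : Function.Injective (edgeMap p r) := by
    have h1 := (edgeMap p r).finrank_range_add_finrank_ker
    rw [hL, Submodule.finrank_orthogonal_span_singleton (n := m) (by intro h; simp [h] at hν),
      finrank_euclideanSpace_fin] at h1
    exact LinearMap.ker_eq_bot.1 (Submodule.finrank_eq_zero.1 (by omega))
  set Ψ : ℝ × Vec m → Vec (m + 1) := fun z => p + edgeMap p r z.2 + z.1 • (q - p) with hΨ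
  have hΨc : Continuous Ψ := by fun_prop
  have hΨi : Function.Injective Ψ := by
    intro z z' h
    have hν0 : ∀ y, inner ℝ ν (edgeMap p r y) = 0 := fun y =>
      Submodule.mem_orthogonal_singleton_iff_inner_right.1 (hL ▸ LinearMap.mem_range_self _ y)
    have h1 : inner ℝ ν (Ψ z) = inner ℝ ν (Ψ z') := by rw [h]
    simp only [hΨ, inner_add_right, hν0, inner_smul_right, add_zero] at h1
    have h2 : z.1 = z'.1 := mul_right_cancel₀ he (by linarith)
    simp only [hΨ, h2, add_left_inj, add_right_inj] at h
    exact Prod.ext h2 (hinj h)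
  rw [convexHull_eq_image_prodCorner, volume_eq_smul_map_transversal (edgeMap p r) ν (q - p) p hν hL he,
    Measure.restrict_smul, integral_smul_measure, ENNReal.toReal_ofReal
      (mul_nonneg (LinearMap.normDet_nonneg _) (abs_nonneg _)),
    setIntegral_map (isCompact_prodCorner.image hΨc).measurableSet hg.aestronglyMeasurable
      hΨc.aemeasurable, preimage_image_eq _ hΨi, smul_eq_mul]
  rfl

/-- The fundamental theorem of calculus along the first coordinate of the corner simplex. -/
theorem integral_prodCorner_deriv {f f' : ℝ × Vec m → ℝ} (hf' : Continuous f')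
    (hd : ∀ s y, HasDerivAt (fun s => f (s, y)) (f' (s, y)) s) (hf : Continuous f) :
    ∫ z in prodCorner m, f' z =
      (∫ y in corner m, f (1 - ∑ j, y j, y)) - ∫ y in corner m, f (0, y) := by
  have hint : IntegrableOn f' (prodCorner m) (volume.prod volume) :=
    hf'.continuousOn.integrableOn_compact isCompact_prodCorner
  rw [← integral_sub
    ((by fun_prop : Continuous fun y : Vec m => f (1 - ∑ j, y j, y)).continuousOn.integrableOn_compact
      isCompact_corner)
    ((by fun_prop : Continuous fun y : Vec m => f (0, y)).continuousOn.integrableOn_compact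
      isCompact_corner), ← integral_indicator isClosed_prodCorner.measurableSet,
    ← integral_indicator isClosed_corner.measurableSet, Measure.volume_eq_prod,
    integral_prod_symm _ (hint.integrable_indicator isClosed_prodCorner.measurableSet)]
  refine integral_congr_ae (Filter.Eventually.of_forall fun y => ?_)
  simp only
  by_cases hy : y ∈ corner m
  -- The fibre of the simplex over `y` is the segment from `0` to `1 - ∑ y`; over points outside the
  -- corner it is empty.
  · have h1 : (fun s => (prodCorner m).indicator f' (s, y)) =
        (Icc 0 (1 - ∑ j, y j)).indicator fun s => f' (s, y) := by
      ext s
      have : (s, y) ∈ prodCorner m ↔ s ∈ Icc 0 (1 - ∑ j, y j) :=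
        ⟨fun h => ⟨h.1, by have := h.2.2; simp only at this; linarith⟩,
          fun h => ⟨h.1, hy.1, by have := h.2; simp only; linarith⟩⟩
      simp only [indicator, this]
    rw [h1, integral_indicator measurableSet_Icc, indicator_of_mem hy, integral_Icc_eq_integral_Ioc,
      ← intervalIntegral.integral_of_le (by linarith [hy.2])]
    exact intervalIntegral.integral_eq_sub_of_hasDerivAt (fun s _ => hd s y)
      ((by fun_prop : Continuous fun s => f' (s, y)).intervalIntegrable _ _)
  · rw [indicator_of_notMem hy]
    have h1 : (fun s => (prodCorner m).indicator f' (s, y)) = 0 := by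
      ext s
      refine indicator_of_notMem (fun h => hy ⟨h.2.1, ?_⟩) _
      have := h.2.2; have := h.1; simp only at *; linarith
    rw [h1]; simp

end Integrals

/-! ### Integrability and linearity of face integrals -/

section FaceIntegral

variable {d : ℕ}

theorem exists_eq_insert_range [DecidableEq (Vec d)] {F : Finset (Vec d)} {p : Vec d} {m : ℕ}
    (hp : p ∈ F) (hF : F.card = m + 1) :
    ∃ r : Fin m → Vec d, range r = ((F.erase p : Finset (Vec d)) : Set (Vec d)) ∧
      (F : Set (Vec d)) = insert p (range r) := by
  have hc : (F.erase p).card = m := by rw [Finset.card_erase_of_mem hp, hF]; rfl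
  have h : range (fun j => (((F.erase p).equivFinOfCardEq hc).symm j : Vec d)) =
      ((F.erase p : Finset (Vec d)) : Set (Vec d)) := by
    rw [range_comp' (fun x : {x // x ∈ F.erase p} => (x : Vec d)), Equiv.range_eq_univ, image_univ,
      Subtype.range_coe_subtype]
    rfl
  refine ⟨_, h, ?_⟩
  rw [h, ← Finset.coe_insert, Finset.insert_erase hp]

theorem isCompact_convexHull_finset (F : Finset (Vec d)) :
    IsCompact (convexHull ℝ (F : Set (Vec d))) :=
  F.finite_toSet.isCompact_convexHull ℝ

theorem isFiniteMeasure_face (hd : 0 < d) {F : Finset (Vec d)} (hF : F.card = d) :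
    IsFiniteMeasure ((Measure.euclideanHausdorffMeasure (d - 1) : Measure (Vec d)).restrict
      (convexHull ℝ (F : Set (Vec d)))) := by
  classical
  obtain ⟨p, hp⟩ := Finset.card_pos.1 (hF ▸ hd)
  obtain ⟨r, -, hr⟩ := exists_eq_insert_range (m := d - 1) hp (by omega)
  refine ⟨?_⟩
  rw [Measure.restrict_apply_univ, hr]
  exact euclideanHausdorffMeasure_convexHull_lt_top p r

theorem integrableOn_face (hd : 0 < d) {F : Finset (Vec d)} (hF : F.card = d) {g : Vec d → ℝ}
    (hg : Continuous g) :
    IntegrableOn g (convexHull ℝ (F : Set (Vec d)))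
      (Measure.euclideanHausdorffMeasure (d - 1)) := by
  have := isFiniteMeasure_face hd hF
  obtain ⟨C, hC⟩ := (isCompact_convexHull_finset F).exists_bound_of_continuousOn hg.continuousOn
  refine Integrable.of_bound hg.aestronglyMeasurable C ?_
  exact ae_restrict_of_forall_mem (isCompact_convexHull_finset F).measurableSet hC

theorem faceIntegral_add (hd : 0 < d) {F : Finset (Vec d)} (hF : F.card = d) {g h : Vec d → ℝ}
    (hg : Continuous g) (hh : Continuous h) :
    faceIntegral F (fun x => g x + h x) = faceIntegral F g + faceIntegral F h :=
  integral_add (integrableOn_face hd hF hg) (integrableOn_face hd hF hh)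

theorem faceIntegral_sum (hd : 0 < d) {F : Finset (Vec d)} (hF : F.card = d) {ι : Type*}
    (s : Finset ι) {g : ι → Vec d → ℝ} (hg : ∀ i ∈ s, Continuous (g i)) :
    faceIntegral F (fun x => ∑ i ∈ s, g i x) = ∑ i ∈ s, faceIntegral F (g i) :=
  integral_finsetSum s fun i hi => integrableOn_face hd hF (hg i hi)

theorem faceIntegral_const_mul (F : Finset (Vec d)) (c : ℝ) (g : Vec d → ℝ) :
    faceIntegral F (fun x => c * g x) = c * faceIntegral F g :=
  integral_const_mul c g

theorem faceIntegral_congr {F : Finset (Vec d)} {g h : Vec d → ℝ}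
    (hgh : ∀ x ∈ convexHull ℝ (F : Set (Vec d)), g x = h x) :
    faceIntegral F g = faceIntegral F h :=
  setIntegral_congr_fun (isCompact_convexHull_finset F).measurableSet hgh

end FaceIntegral

/-! ### The divergence theorem on a simplex -/

section Divergence

variable {d : ℕ} {T : Finset (Vec d)}

theorem affineSpan_cell_eq_top (hT : AffineIndependent ℝ ((↑) : {x // x ∈ T} → Vec d))
    (hc : T.card = d + 1) : affineSpan ℝ (T : Set (Vec d)) = ⊤ := by
  have h := hT.affineSpan_eq_top_iff_card_eq_finrank_add_one.2 (by simp [hc])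
  rw [Subtype.range_coe_subtype] at h
  exact h

theorem volume_cell_pos (hT : AffineIndependent ℝ ((↑) : {x // x ∈ T} → Vec d))
    (hc : T.card = d + 1) : 0 < volume.real (convexHull ℝ (T : Set (Vec d))) := by
  refine ENNReal.toReal_pos ?_ (isCompact_convexHull_finset T).measure_lt_top.ne
  have := (interior_convexHull_nonempty_iff_affineSpan_eq_top (s := (T : Set (Vec d)))).2
    (affineSpan_cell_eq_top hT hc)
  exact ((isOpen_interior.measure_pos _ this).trans_le (measure_mono interior_subset)).ne'

theorem divergence_eq_sum {w : Vec d → Vec d} {x : Vec d} (hw : DifferentiableAt ℝ w x) :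
    divergence w x = ∑ i, fderiv ℝ (fun y => w y i) x (EuclideanSpace.single i 1) := by
  rw [divergence, Matrix.trace]
  refine Finset.sum_congr rfl fun i _ => ?_
  have : fderiv ℝ (fun y => w y i) x =
      (EuclideanSpace.proj i : Vec d →L[ℝ] ℝ).comp (fderiv ℝ w x) :=
    ((EuclideanSpace.proj i : Vec d →L[ℝ] ℝ).hasFDerivAt.comp x hw.hasFDerivAt).fderiv
  rw [this]
  rfl

variable [DecidableEq (Vec d)]

/-- The fundamental theorem of calculus on a simplex along one of its edges. -/
theorem integral_fderiv_edge (hT : AffineIndependent ℝ ((↑) : {x // x ∈ T} → Vec d))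
    (hc : T.card = d + 1) {p q : Vec d} (hp : p ∈ T) (hq : q ∈ T) (hpq : p ≠ q)
    {g : Vec d → ℝ} (hg : ContDiff ℝ 1 g) :
    ∫ x in convexHull ℝ (T : Set (Vec d)), fderiv ℝ g x (q - p) =
      inner ℝ (outerNormal T (T.erase p)) (q - p) * faceIntegral (T.erase p) g +
      inner ℝ (outerNormal T (T.erase q)) (q - p) * faceIntegral (T.erase q) g := by
  have hqp : q ∈ T.erase p := Finset.mem_erase.2 ⟨hpq.symm, hq⟩
  have hpq' : p ∈ T.erase q := Finset.mem_erase.2 ⟨hpq, hp⟩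
  have hcp : (T.erase p).card = d := by rw [Finset.card_erase_of_mem hp, hc]; rfl
  have hcq : (T.erase q).card = d := by rw [Finset.card_erase_of_mem hq, hc]; rfl
  obtain ⟨m, rfl⟩ : ∃ m, d = m + 1 := Nat.exists_eq_succ_of_ne_zero (by
    rintro rfl; exact Finset.ne_empty_of_mem hqp (Finset.card_eq_zero.1 hcp))
  obtain ⟨r, hr, hFp⟩ := exists_eq_insert_range hqp hcp
  have hFq : ((T.erase q : Finset _) : Set (Vec (m + 1))) = insert p (range r) := by
    rw [hr, ← Finset.coe_insert, Finset.erase_right_comm, Finset.insert_erase hpq']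
  have hTq : (T : Set (Vec (m + 1))) = insert q (insert p (range r)) := by
    rw [← hFq, ← Finset.coe_insert, Finset.insert_erase hq]
  have hTp : (T : Set (Vec (m + 1))) = insert p (insert q (range r)) := by
    rw [hTq, insert_comm]
  set νp := outerNormal T (T.erase p)
  set νq := outerNormal T (T.erase q)
  have hνp : ‖νp‖ = 1 := norm_outerNormal hT hp ⟨q, hqp⟩
  have hνq : ‖νq‖ = 1 := norm_outerNormal hT hq ⟨p, hpq'⟩
  have hip : inner ℝ νp (p - q) < 0 := inner_outerNormal_neg hT hp hqp
  have hiq : inner ℝ νq (q - p) < 0 := inner_outerNormal_neg hT hq hpq'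
  have hip' : inner ℝ νp (p - q) = - inner ℝ νp (q - p) := by rw [← inner_neg_right, neg_sub]
  have hLp : (edgeMap q r).range = (ℝ ∙ νp)ᗮ := by
    rw [range_edgeMap, ← hFp]; exact vectorSpan_erase_eq hT hp hc ⟨q, hqp⟩
  have hLq : (edgeMap p r).range = (ℝ ∙ νq)ᗮ := by
    rw [range_edgeMap, ← hFq]; exact vectorSpan_erase_eq hT hq hc ⟨p, hpq'⟩
  have hgc := hg.continuous
  have hg' : Continuous fun x => fderiv ℝ g x (q - p) :=
    (hg.continuous_fderiv one_ne_zero).clm_apply continuous_const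
  have hfp : faceIntegral (T.erase p) g =
      (edgeMap q r).normDet * ∫ y in corner m, g (q + edgeMap q r y) := by
    rw [faceIntegral, hFp]; exact integral_face q r hgc
  have hfq : faceIntegral (T.erase q) g =
      (edgeMap p r).normDet * ∫ y in corner m, g (p + edgeMap p r y) := by
    rw [faceIntegral, hFq]; exact integral_face p r hgc
  -- The volume of the cell is computed with either facet as base. Comparison shows that base times
  -- height is the same for both, which later converts the factor in front of the facet opposite
  -- `p`.
  have hvq := integral_cell p q r hνq hLq hiq.ne (continuous_const (y := (1 : ℝ)))
  have hvp := integral_cell q p r hνp hLp hip.ne (continuous_const (y := (1 : ℝ)))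
  rw [← hTq] at hvq
  rw [← hTp, hvq] at hvp
  have hpos : 0 < ∫ x in convexHull ℝ (T : Set (Vec (m + 1))), (1 : ℝ) := by
    simpa using volume_cell_pos hT hc
  have hI : (∫ z in prodCorner m, (1 : ℝ)) ≠ 0 := by
    intro h; rw [hvq, h, mul_zero] at hpos; exact lt_irrefl _ hpos
  have hconst := mul_right_cancel₀ hI hvp
  have hL : Continuous (edgeMap p r) := (edgeMap p r).continuous_of_finiteDimensional
  have hftc := integral_prodCorner_deriv (m := m)
    (f := fun z => g (p + edgeMap p r z.2 + z.1 • (q - p)))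
    (f' := fun z => fderiv ℝ g (p + edgeMap p r z.2 + z.1 • (q - p)) (q - p))
    (hg'.comp (by fun_prop : Continuous fun z : ℝ × Vec m =>
      p + edgeMap p r z.2 + z.1 • (q - p)))
    (fun s y => by
      have h1 : HasDerivAt (fun s : ℝ => p + edgeMap p r y + s • (q - p)) (q - p) s := by
        simpa using ((hasDerivAt_id s).smul_const (q - p)).const_add (p + edgeMap p r y)
      exact ((hg.differentiable one_ne_zero _).hasFDerivAt).comp_hasDerivAt s h1)
    (by fun_prop)
  -- A line in direction `q - p` enters through the facet opposite `q` at parameter `0` and leaves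
  -- through the facet opposite `p` at parameter `1 - ∑ y`.
  have hshift : ∀ y : Vec m, p + edgeMap p r y + (1 - ∑ j, y j) • (q - p) =
      q + edgeMap q r y := by
    intro y
    simp only [edgeMap_apply, smul_sub, Finset.sum_sub_distrib, sub_smul, one_smul,
      ← Finset.sum_smul]
    abel
  simp only [hshift, zero_smul, add_zero] at hftc
  have hcell := integral_cell p q r hνq hLq hiq.ne hg'
  rw [← hTq] at hcell
  rw [hcell, hftc, hfp, hfq, mul_sub]
  rw [abs_of_neg hiq, abs_of_neg hip, hip'] at *
  linear_combination (∫ y in corner m, g (q + edgeMap q r y)) * hconst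

/-- Both sides are linear in `e`, so it suffices to take `e` among the edges from a fixed vertex
`p`, which span the space. For `e = q - p` only the facets opposite `p` and `q` contribute: every
other facet contains both vertices, hence its normal is orthogonal to `e`. -/
theorem integral_fderiv_cell (hT : AffineIndependent ℝ ((↑) : {x // x ∈ T} → Vec d))
    (hc : T.card = d + 1) {g : Vec d → ℝ} (hg : ContDiff ℝ 1 g) (e : Vec d) :
    ∫ x in convexHull ℝ (T : Set (Vec d)), fderiv ℝ g x e =
      ∑ v ∈ T, inner ℝ (outerNormal T (T.erase v)) e * faceIntegral (T.erase v) g := by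
  have hint : IntegrableOn (fderiv ℝ g) (convexHull ℝ (T : Set (Vec d))) :=
    (hg.continuous_fderiv one_ne_zero).continuousOn.integrableOn_compact
      (isCompact_convexHull_finset T)
  have happ : ∀ e, ∫ x in convexHull ℝ (T : Set (Vec d)), fderiv ℝ g x e =
      (∫ x in convexHull ℝ (T : Set (Vec d)), fderiv ℝ g x) e := fun e =>
    (ContinuousLinearMap.integral_apply hint e).symm
  set Λ := ∫ x in convexHull ℝ (T : Set (Vec d)), fderiv ℝ g x
  set Γ : Vec d →L[ℝ] ℝ := ∑ v ∈ T,
    faceIntegral (T.erase v) g • innerSL ℝ (outerNormal T (T.erase v))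
  have hΓ : ∀ e, Γ e =
      ∑ v ∈ T, inner ℝ (outerNormal T (T.erase v)) e * faceIntegral (T.erase v) g := fun e => by
    simp [Γ, mul_comm]
  obtain ⟨p, hp⟩ : T.Nonempty := Finset.card_pos.1 (by omega)
  have hspan : Submodule.span ℝ ((· -ᵥ p) '' (T : Set (Vec d))) = ⊤ := by
    rw [← vectorSpan_eq_span_vsub_set_right ℝ (Finset.mem_coe.2 hp), ← direction_affineSpan,
      affineSpan_cell_eq_top hT hc, AffineSubspace.direction_top]
  have hedge : ∀ q ∈ T, Λ (q - p) = Γ (q - p) := by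
    intro q hq
    by_cases hpq : p = q
    · simp [hpq]
    rw [← happ, hΓ, integral_fderiv_edge hT hc hp hq hpq hg, ← Finset.sum_pair hpq
      (f := fun v => inner ℝ (outerNormal T (T.erase v)) (q - p) * faceIntegral (T.erase v) g)]
    refine Finset.sum_subset (Finset.insert_subset hp (Finset.singleton_subset_iff.2 hq)) ?_
    intro v hv hv'
    simp only [Finset.mem_insert, Finset.mem_singleton, not_or] at hv'
    rw [inner_outerNormal_eq_zero hT hv (Finset.mem_erase.2 ⟨Ne.symm hv'.1, hp⟩)
      (Finset.mem_erase.2 ⟨Ne.symm hv'.2, hq⟩), zero_mul]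
  rw [happ, ← hΓ]
  have : (Λ : Vec d →ₗ[ℝ] ℝ) = Γ := by
    refine LinearMap.ext_on hspan ?_
    rintro _ ⟨q, hq, rfl⟩
    exact hedge q hq
  exact LinearMap.congr_fun this e

/-- The divergence theorem on a simplex. -/
theorem integral_divergence_cell (hd : 0 < d)
    (hT : AffineIndependent ℝ ((↑) : {x // x ∈ T} → Vec d))
    (hc : T.card = d + 1) {w : Vec d → Vec d} (hw : ContDiff ℝ 1 w) :
    ∫ x in convexHull ℝ (T : Set (Vec d)), divergence w x =
      ∑ v ∈ T, faceIntegral (T.erase v)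
        (fun x => inner ℝ (w x) (outerNormal T (T.erase v))) := by
  have hwi : ∀ i, ContDiff ℝ 1 fun y => w y i := fun i => contDiff_euclidean.1 hw i
  have hcv : ∀ v ∈ T, (T.erase v).card = d := fun v hv => by
    rw [Finset.card_erase_of_mem hv, hc]; rfl
  calc _ = ∑ i, ∫ x in convexHull ℝ (T : Set (Vec d)),
        fderiv ℝ (fun y => w y i) x (EuclideanSpace.single i 1) := by
        rw [← integral_finsetSum]
        · exact setIntegral_congr_fun (isCompact_convexHull_finset T).measurableSet fun x _ =>
            divergence_eq_sum (hw.differentiable one_ne_zero x)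
        · intro i _
          exact (((hwi i).continuous_fderiv one_ne_zero).clm_apply
            continuous_const).continuousOn.integrableOn_compact (isCompact_convexHull_finset T)
    _ = ∑ v ∈ T, ∑ i, outerNormal T (T.erase v) i *
          faceIntegral (T.erase v) fun y => w y i := by
        rw [Finset.sum_comm]
        refine Finset.sum_congr rfl fun i _ => ?_
        rw [integral_fderiv_cell hT hc (hwi i)]
        simp [EuclideanSpace.inner_single_right]
    _ = _ := by
        refine Finset.sum_congr rfl fun v hv => ?_
        simp only [← faceIntegral_const_mul]
        rw [← faceIntegral_sum hd (hcv v hv)]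
        · simp [PiLp.inner_apply]
        · intro i _
          exact continuous_const.mul (hwi i).continuous

end Divergence

/-! ### Facets of a conforming triangulation -/

section Facets

variable {d : ℕ}

/-- The centroid of a finite set lies in the relative interior of its convex hull. -/
theorem exists_centroid_add_smul_mem {F : Finset (Vec d)} (hF : F.Nonempty) {u : Vec d}
    (hu : u ∈ vectorSpan ℝ (F : Set (Vec d))) :
    ∃ δ > 0, ∀ ε : ℝ, |ε| ≤ δ → F.centroid ℝ id + ε • u ∈ convexHull ℝ (F : Set (Vec d)) := by
  classical
  have hcF : (0 : ℝ) < F.card := by exact_mod_cast hF.card_pos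
  rw [vectorSpan_def] at hu
  induction hu using Submodule.span_induction with
  | mem u h =>
    obtain ⟨f, hf, g, hg, rfl⟩ := h
    rw [Finset.mem_coe] at hf hg
    refine ⟨(F.card : ℝ)⁻¹, by positivity, fun ε hε => ?_⟩
    rw [abs_le] at hε
    rw [Finset.mem_convexHull']
    by_cases hfg : f = g
    · refine ⟨fun _ => (F.card : ℝ)⁻¹, fun _ _ => by positivity, ?_, ?_⟩
      · rw [Finset.sum_const, nsmul_eq_mul, mul_inv_cancel₀ hcF.ne']
      · simp [hfg, centroid_eq_smul_sum hF, Finset.smul_sum]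
    -- All barycentric weights of the centroid equal `1 / card F`, which leaves room to shift a
    -- weight `ε` of at most that size between `g` and `f`.
    refine ⟨fun x => (F.card : ℝ)⁻¹ + ((if x = f then ε else 0) - if x = g then ε else 0),
      fun x hx => ?_, ?_, ?_⟩
    · dsimp only
      split_ifs with h1 h2 h2
      · exact absurd (h1.symm.trans h2) hfg
      all_goals linarith [inv_pos.2 hcF]
    · rw [Finset.sum_add_distrib, Finset.sum_sub_distrib, Finset.sum_ite_eq' F f,
        Finset.sum_ite_eq' F g, if_pos hf, if_pos hg, Finset.sum_const, nsmul_eq_mul,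
        mul_inv_cancel₀ hcF.ne']
      ring
    · simp only [add_smul, sub_smul, Finset.sum_add_distrib, Finset.sum_sub_distrib, ite_smul,
        zero_smul]
      rw [Finset.sum_ite_eq' F f, Finset.sum_ite_eq' F g, if_pos hf, if_pos hg,
        centroid_eq_smul_sum hF, Finset.smul_sum, vsub_eq_sub, smul_sub]
  | zero =>
    exact ⟨1, one_pos, fun ε _ => by
      simpa using F.centroid_mem_convexHull (R := ℝ) hF⟩
  | add u v _ _ hu hv =>
    obtain ⟨δ₁, h₁, hu⟩ := hu
    obtain ⟨δ₂, h₂, hv⟩ := hv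
    -- The point shifted by `ε (u + v)` is the midpoint of those shifted by `2 ε u` and `2 ε v`.
    refine ⟨min δ₁ δ₂ / 2, by positivity, fun ε hε => ?_⟩
    have h2 : |2 * ε| ≤ min δ₁ δ₂ := by rw [abs_mul, abs_two]; linarith
    have := (convex_convexHull ℝ (F : Set (Vec d))) (hu (2 * ε) (h2.trans (min_le_left _ _)))
      (hv (2 * ε) (h2.trans (min_le_right _ _))) (a := 1 / 2) (b := 1 / 2) (by norm_num)
      (by norm_num) (by norm_num)
    convert this using 1
    module
  | smul r u _ hu =>
    obtain ⟨δ, h, hu⟩ := hu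
    -- The summand `1` keeps the quotient meaningful for `r = 0`.
    refine ⟨δ / (|r| + 1), by positivity, fun ε hε => ?_⟩
    rw [smul_smul]
    refine hu _ ?_
    rw [le_div_iff₀ (by positivity)] at hε
    rw [abs_mul]
    nlinarith [abs_nonneg ε]

theorem exists_erase_eq [DecidableEq (Vec d)] {T F : Finset (Vec d)} (hT : T.card = d + 1)
    (hFT : F ⊆ T) (hF : F.card = d) : ∃ q ∈ T, F = T.erase q := by
  obtain ⟨q, hq, rfl⟩ := Finset.exists_eq_insert_iff.2 ⟨hFT, by rw [hF, hT]⟩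
  exact ⟨q, Finset.mem_insert_self _ _, (Finset.erase_insert hq).symm⟩

theorem inner_outerNormal_hull [DecidableEq (Vec d)] {T : Finset (Vec d)}
    (hT : AffineIndependent ℝ ((↑) : {x // x ∈ T} → Vec d)) {q : Vec d} (hq : q ∈ T)
    {x y : Vec d} (hx : x ∈ convexHull ℝ ((T.erase q : Finset (Vec d)) : Set (Vec d)))
    (hy : y ∈ convexHull ℝ ((T.erase q : Finset (Vec d)) : Set (Vec d))) :
    inner ℝ (outerNormal T (T.erase q)) (x - y) = 0 := by
  have hF : (T.erase q).Nonempty :=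
    Finset.coe_nonempty.1 (convexHull_nonempty_iff.1 ⟨x, hx⟩)
  refine Submodule.inner_left_of_mem_orthogonal ?_ (outerNormal_spec hT hq hF).2.1
  rw [← direction_affineSpan]
  exact AffineSubspace.vsub_mem_direction (convexHull_subset_affineSpan _ hx)
    (convexHull_subset_affineSpan _ hy)

theorem inner_outerNormal_neg_of_hull [DecidableEq (Vec d)] {T : Finset (Vec d)}
    (hT : AffineIndependent ℝ ((↑) : {x // x ∈ T} → Vec d)) {q : Vec d} (hq : q ∈ T)
    {y : Vec d} (hy : y ∈ convexHull ℝ ((T.erase q : Finset (Vec d)) : Set (Vec d))) :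
    inner ℝ (outerNormal T (T.erase q)) (q - y) < 0 := by
  have hF : (T.erase q).Nonempty :=
    Finset.coe_nonempty.1 (convexHull_nonempty_iff.1 ⟨y, hy⟩)
  obtain ⟨p, hp⟩ := hF
  have h1 := inner_outerNormal_neg hT hq hp
  have h2 := inner_outerNormal_hull hT hq (subset_convexHull ℝ _ (Finset.mem_coe.2 hp)) hy
  have : q - y = (q - p) + (p - y) := by abel
  rw [this, inner_add_right, h2, add_zero]
  exact h1

/-- A cell lies on the inner side of each of its facets. -/
theorem inner_outerNormal_nonpos [DecidableEq (Vec d)] {T : Finset (Vec d)}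
    (hT : AffineIndependent ℝ ((↑) : {x // x ∈ T} → Vec d)) {q : Vec d} (hq : q ∈ T)
    {x y : Vec d} (hx : x ∈ convexHull ℝ (T : Set (Vec d)))
    (hy : y ∈ convexHull ℝ ((T.erase q : Finset (Vec d)) : Set (Vec d))) :
    inner ℝ (outerNormal T (T.erase q)) (x - y) ≤ 0 := by
  have hconv : Convex ℝ {x | inner ℝ (outerNormal T (T.erase q)) (x - y) ≤ 0} := by
    have : {x | inner ℝ (outerNormal T (T.erase q)) (x - y) ≤ 0} =
        {x | inner ℝ (outerNormal T (T.erase q)) x ≤ inner ℝ (outerNormal T (T.erase q)) y} := by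
      ext z; simp [inner_sub_right]
    rw [this]
    exact convex_halfSpace_le (innerSL ℝ (outerNormal T (T.erase q))).isLinear _
  refine convexHull_min ?_ hconv hx
  intro v hv
  by_cases hvq : v = q
  · rw [hvq]; exact (inner_outerNormal_neg_of_hull hT hq hy).le
  · exact (inner_outerNormal_hull hT hq (subset_convexHull ℝ _
      (Finset.mem_coe.2 (Finset.mem_erase.2 ⟨hvq, hv⟩))) hy).le

variable {Ω : Set (Vec d)} (M : Triangulation d Ω)

/-- The two cells at an interface have opposite normals. -/
theorem outerNormal_eq_neg (hd : 0 < d) {T₁ T₂ F : Finset (Vec d)} (h₁ : T₁ ∈ M.cells)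
    (h₂ : T₂ ∈ M.cells) (hne : T₁ ≠ T₂) (hF₁ : F ⊆ T₁) (hF₂ : F ⊆ T₂) (hF : F.card = d) :
    outerNormal T₂ F = - outerNormal T₁ F := by
  classical
  obtain ⟨a, ha, hFa⟩ := exists_erase_eq (M.card_eq T₁ h₁) hF₁ hF
  obtain ⟨b, hb, hFb⟩ := exists_erase_eq (M.card_eq T₂ h₂) hF₂ hF
  have i₁ := M.affineIndependent T₁ h₁
  have i₂ := M.affineIndependent T₂ h₂
  have hFn : F.Nonempty := Finset.card_pos.1 (by omega)
  have e₁ := vectorSpan_erase_eq i₁ ha (M.card_eq T₁ h₁) (hFa ▸ hFn)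
  have e₂ := vectorSpan_erase_eq i₂ hb (M.card_eq T₂ h₂) (hFb ▸ hFn)
  have n₁ := norm_outerNormal i₁ ha (hFa ▸ hFn)
  have n₂ := norm_outerNormal i₂ hb (hFb ▸ hFn)
  have s₁ := fun y hy => inner_outerNormal_neg_of_hull i₁ ha (y := y) hy
  have s₂ := fun y hy => inner_outerNormal_neg_of_hull i₂ hb (y := y) hy
  have z₁ := fun x y hx hy => inner_outerNormal_hull i₁ ha (x := x) (y := y) hx hy
  rw [← hFa] at e₁ n₁ s₁ z₁
  rw [← hFb] at e₂ n₂ s₂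
  set ν := outerNormal T₁ F
  -- Both unit normals span the orthogonal complement of the facet direction, so they agree up to
  -- sign.
  have hmem : outerNormal T₂ F ∈ (ℝ ∙ ν) := by
    rw [← Submodule.orthogonal_orthogonal (ℝ ∙ ν), ← e₁, e₂, Submodule.orthogonal_orthogonal]
    exact Submodule.mem_span_singleton_self _
  obtain ⟨c, hc⟩ := Submodule.mem_span_singleton.1 hmem
  have hc1 : |c| = 1 := by
    rw [← hc, norm_smul, n₁, mul_one, Real.norm_eq_abs] at n₂; exact n₂
  rcases eq_or_eq_neg_of_abs_eq hc1 with rfl | rfl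
  swap
  · rw [← hc]; simp
  -- Equal normals would put both cells on the same side of `F`. They would then share a point near
  -- the centroid of `F` but off `F`, which conformity forbids.
  exfalso
  rw [← hc, one_smul] at s₂
  set p := F.centroid ℝ id with hp
  have hpF : p ∈ convexHull ℝ (F : Set (Vec d)) := F.centroid_mem_convexHull hFn
  have hA := s₁ p hpF
  have hB := s₂ p hpF
  -- This choice makes `u = (a - p) - l (b - p)` tangential to `F`.
  set l : ℝ := inner ℝ ν (a - p) / inner ℝ ν (b - p) with hl
  have hlpos : 0 < l := div_pos_of_neg_of_neg hA hB
  set u := (a - p) - l • (b - p) with hu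
  have huF : u ∈ vectorSpan ℝ (F : Set (Vec d)) := by
    rw [e₁, Submodule.mem_orthogonal_singleton_iff_inner_right, hu, inner_sub_right,
      inner_smul_right, hl, div_mul_cancel₀ _ hB.ne, sub_self]
  obtain ⟨δ, hδ, hδF⟩ := exists_centroid_add_smul_mem hFn huF
  -- The common point is `p + ε (a - p) = (1 - ε l) (p + ε / (1 - ε l) u) + ε l b`. Since `1 - ε l ≥
  -- 1 / 2`, the bound `2 ε ≤ δ` keeps the point in brackets inside `F`.
  obtain ⟨ε, hε0, hε1, hε2, hε3⟩ : ∃ ε : ℝ, 0 < ε ∧ ε ≤ 1 ∧ ε * l ≤ 1 / 2 ∧ 2 * ε ≤ δ := by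
    refine ⟨min 1 (min (1 / (2 * l)) (δ / 2)), by positivity, min_le_left _ _, ?_, ?_⟩
    · have : min 1 (min (1 / (2 * l)) (δ / 2)) ≤ 1 / (2 * l) :=
        (min_le_right _ _).trans (min_le_left _ _)
      calc _ ≤ 1 / (2 * l) * l := by gcongr
        _ = 1 / 2 := by field_simp
    · have : min 1 (min (1 / (2 * l)) (δ / 2)) ≤ δ / 2 :=
        (min_le_right _ _).trans (min_le_right _ _)
      linarith
  have m₁ : p + ε • (a - p) ∈ convexHull ℝ (T₁ : Set (Vec d)) := by
    have := (convex_convexHull ℝ (T₁ : Set (Vec d)))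
      (convexHull_mono (Finset.coe_subset.2 hF₁) hpF) (subset_convexHull ℝ _ (Finset.mem_coe.2 ha))
      (a := 1 - ε) (b := ε) (by linarith) hε0.le (by ring)
    convert this using 1
    module
  have m₂ : p + ε • (a - p) ∈ convexHull ℝ (T₂ : Set (Vec d)) := by
    have hpos : 0 < 1 - ε * l := by linarith
    have hq : p + (ε / (1 - ε * l)) • u ∈ convexHull ℝ (F : Set (Vec d)) := by
      refine hδF _ ?_
      rw [abs_of_pos (by positivity), div_le_iff₀ hpos]
      nlinarith
    have := (convex_convexHull ℝ (T₂ : Set (Vec d)))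
      (convexHull_mono (Finset.coe_subset.2 hF₂) hq) (subset_convexHull ℝ _ (Finset.mem_coe.2 hb))
      (a := 1 - ε * l) (b := ε * l) hpos.le (by positivity) (by ring)
    convert this using 1
    rw [smul_add, smul_smul, mul_div_cancel₀ _ hpos.ne', hu]
    module
  obtain ⟨S, hS₁, hS₂, hS⟩ := M.conforming T₁ h₁ T₂ h₂
  -- If `a` belonged to the common face, then `T₁ = F ∪ {a}` would be contained in `T₂`, and equal
  -- to it by cardinality.
  have hSF : S ⊆ F := by
    intro x hx
    rw [hFa, Finset.mem_erase]
    refine ⟨?_, hS₁ hx⟩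
    rintro rfl
    apply hne
    refine Finset.eq_of_subset_of_card_le ?_ (by rw [M.card_eq T₁ h₁, M.card_eq T₂ h₂])
    rw [← Finset.insert_erase ha, ← hFa]
    exact Finset.insert_subset (hS₂ hx) hF₂
  have hx : p + ε • (a - p) ∈ convexHull ℝ (F : Set (Vec d)) :=
    convexHull_mono (Finset.coe_subset.2 hSF) (hS ▸ ⟨m₁, m₂⟩)
  have := z₁ _ p hx hpF
  rw [add_sub_cancel_left, inner_smul_right] at this
  exact (mul_neg_of_pos_of_neg hε0 hA).ne this

end Facets

/-! ### Interfaces, boundary faces and piecewise integration by parts -/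

section Skeleton

variable {d : ℕ} {Ω : Set (Vec d)} (M : Triangulation d Ω)

theorem mem_facets {F : Finset (Vec d)} :
    F ∈ M.facets ↔ ∃ T ∈ M.cells, F ⊆ T ∧ F.card = d := by
  classical
  simp [Triangulation.facets, Finset.mem_powersetCard]

theorem card_of_mem_facets {F : Finset (Vec d)} (hF : F ∈ M.facets) : F.card = d := by
  obtain ⟨T, -, -, hFc⟩ := (mem_facets M).1 hF
  exact hFc

/-- A facet that is not an interface lies in the boundary of the domain. -/
theorem mem_boundaryFaces_of_notMem_interfaces (hd : 0 < d) (hΩ : interior (closure Ω) = Ω)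
    {F : Finset (Vec d)} (hF : F ∈ M.facets) (hFi : F ∉ M.interfaces) : F ∈ M.boundaryFaces := by
  classical
  rw [Triangulation.boundaryFaces, Finset.mem_filter]
  refine ⟨hF, fun x hx => ?_⟩
  obtain ⟨T, hT, hFT, hFc⟩ := (mem_facets M).1 hF
  have huniq : ∀ T' ∈ M.cells, T' ≠ T → ¬ F ⊆ T' := fun T' hT' hne h =>
    hFi (Finset.mem_filter.2 ⟨hF, T', hT', T, hT, hne, h, hFT⟩)
  obtain ⟨q, hq, hFq⟩ := exists_erase_eq (M.card_eq T hT) hFT hFc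
  have hi := M.affineIndependent T hT
  have hFn : F.Nonempty := Finset.card_pos.1 (by omega)
  have hopen : IsOpen Ω := hΩ ▸ isOpen_interior
  have hcl : ∀ T : Finset (Vec d), IsClosed (convexHull ℝ (T : Set (Vec d))) := fun T =>
    (isCompact_convexHull_finset T).isClosed
  set c := F.centroid ℝ id
  have hcF : c ∈ convexHull ℝ (F : Set (Vec d)) := F.centroid_mem_convexHull hFn
  -- points in the relative interior of the facet lie in no other cell
  have hother : ∀ δ : ℝ, 0 < δ → δ ≤ 1 → ∀ T' ∈ M.cells, T' ≠ T →
      (1 - δ) • x + δ • c ∉ convexHull ℝ (T' : Set (Vec d)) := by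
    intro δ hδ0 hδ1 T' hT' hne hp
    have hpF : (1 - δ) • x + δ • c ∈ convexHull ℝ (F : Set (Vec d)) :=
      convex_convexHull ℝ _ hx hcF (by linarith) hδ0.le (by ring)
    obtain ⟨S, hS, hS', hSe⟩ := M.conforming T hT T' hT'
    have hpS : (1 - δ) • x + δ • c ∈ convexHull ℝ (S : Set (Vec d)) :=
      hSe ▸ ⟨convexHull_mono (Finset.coe_subset.2 hFT) hpF, hp⟩
    -- No other cell contains `F`, so the common face `S` misses a vertex `f` of `F` and lies in the
    -- facet of `T` opposite `f`. The point, however, has positive weight at the centroid `c`, which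
    -- is strictly on the inner side of that facet.
    obtain ⟨f, hfF, hfS⟩ := Finset.not_subset.1 fun h : F ⊆ S => huniq T' hT' hne (h.trans hS')
    have hfT := hFT hfF
    have hqf : q ∈ T.erase f := by
      rw [hFq] at hfF
      exact Finset.mem_erase.2 ⟨(Finset.ne_of_mem_erase hfF).symm, hq⟩
    have hqh : q ∈ convexHull ℝ ((T.erase f : Finset (Vec d)) : Set (Vec d)) :=
      subset_convexHull ℝ _ (Finset.mem_coe.2 hqf)
    set ν := outerNormal T (T.erase f)
    have h0 : inner ℝ ν ((1 - δ) • x + δ • c - q) = 0 := by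
      refine inner_outerNormal_hull hi hfT (convexHull_mono ?_ hpS) hqh
      exact Finset.coe_subset.2 fun y hy => Finset.mem_erase.2 ⟨by rintro rfl; exact hfS hy, hS hy⟩
    have hxν : inner ℝ ν (x - q) ≤ 0 := inner_outerNormal_nonpos hi hfT
      (convexHull_mono (Finset.coe_subset.2 hFT) hx) hqh
    have hcν : inner ℝ ν (c - q) < 0 := by
      have hcard : (0 : ℝ) < F.card := by exact_mod_cast hFn.card_pos
      have : c - q = (F.card : ℝ)⁻¹ • ∑ g ∈ F, (g - q) := by
        rw [Finset.sum_sub_distrib, smul_sub, ← centroid_eq_smul_sum hFn, Finset.sum_const,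
          ← Nat.cast_smul_eq_nsmul ℝ, smul_smul, inv_mul_cancel₀ hcard.ne', one_smul]
      rw [this, inner_smul_right, inner_sum]
      refine mul_neg_of_pos_of_neg (inv_pos.2 hcard) ?_
      refine (Finset.sum_lt_sum (g := fun _ => (0 : ℝ)) (fun g hg => ?_) ⟨f, hfF, ?_⟩).trans_eq
        Finset.sum_const_zero
      · exact inner_outerNormal_nonpos hi hfT (subset_convexHull ℝ _ (Finset.mem_coe.2 (hFT hg))) hqh
      · exact inner_outerNormal_neg_of_hull hi hfT hqh
    have : (1 - δ) • x + δ • c - q = (1 - δ) • (x - q) + δ • (c - q) := by module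
    rw [this, inner_add_right, inner_smul_right, inner_smul_right] at h0
    nlinarith
  have hmem : ∀ δ : ℝ, 0 < δ → δ ≤ 1 → (1 - δ) • x + δ • c ∈ frontier Ω := by
    intro δ hδ0 hδ1
    set p := (1 - δ) • x + δ • c
    have hpF : p ∈ convexHull ℝ (F : Set (Vec d)) :=
      convex_convexHull ℝ _ hx hcF (by linarith) hδ0.le (by ring)
    refine ⟨?_, fun hpi => ?_⟩
    · rw [← M.cover]
      exact mem_iUnion₂.2 ⟨T, hT, convexHull_mono (Finset.coe_subset.2 hFT) hpF⟩
    rw [hopen.interior_eq] at hpi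
    set ν := outerNormal T F
    have hν : ‖ν‖ = 1 := by
      have := norm_outerNormal hi hq (hFq ▸ hFn)
      rwa [← hFq] at this
    -- Were `p` in the open set `Ω`, a small step along the outer normal would stay in `Ω` and avoid
    -- all other cells, which are closed, while leaving `T`. This contradicts the covering.
    have hN : Ω ∩ ⋂ T' ∈ M.cells.erase T, (convexHull ℝ (T' : Set (Vec d)))ᶜ ∈ nhds p := by
      refine Filter.inter_mem (hopen.mem_nhds hpi) ?_
      rw [Filter.biInter_finset_mem]
      intro T' hT'
      rw [Finset.mem_erase] at hT'
      exact (hcl T').isOpen_compl.mem_nhds (hother δ hδ0 hδ1 T' hT'.2 hT'.1)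
    have htend : Filter.Tendsto (fun ε : ℝ => p + ε • ν) (nhdsWithin 0 (Ioi 0)) (nhds p) := by
      have : Continuous fun ε : ℝ => p + ε • ν := by fun_prop
      simpa using (this.tendsto 0).mono_left nhdsWithin_le_nhds
    obtain ⟨ε, hε, hε0⟩ := ((htend.eventually_mem hN).and self_mem_nhdsWithin).exists
    have hcov : p + ε • ν ∈ ⋃ T ∈ M.cells, convexHull ℝ (T : Set (Vec d)) :=
      M.cover ▸ subset_closure hε.1
    obtain ⟨T', hT', hp'⟩ := mem_iUnion₂.1 hcov
    by_cases hne : T' = T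
    · have hle := inner_outerNormal_nonpos hi hq (hne ▸ hp') (hFq ▸ hpF)
      rw [← hFq, add_sub_cancel_left, inner_smul_right, real_inner_self_eq_norm_sq, hν] at hle
      have : 0 < ε := hε0
      linarith
    · exact mem_iInter₂.1 hε.2 T' (Finset.mem_erase.2 ⟨hne, hT'⟩) hp'
  -- An arbitrary point `x` of the facet is a limit of relative interior points, and the frontier is
  -- closed.
  have htend : Filter.Tendsto (fun δ : ℝ => (1 - δ) • x + δ • c) (nhdsWithin 0 (Ioi 0))
      (nhds x) := by
    have : Continuous fun δ : ℝ => (1 - δ) • x + δ • c := by fun_prop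
    simpa using (this.tendsto 0).mono_left nhdsWithin_le_nhds
  refine isClosed_frontier.mem_of_tendsto htend ?_
  filter_upwards [Ioc_mem_nhdsGT (zero_lt_one (α := ℝ))] with δ hδ
  exact hmem δ hδ.1 hδ.2

theorem mem_facets_of_mem_interfaces {F : Finset (Vec d)} (hF : F ∈ M.interfaces) :
    F ∈ M.facets := by
  classical
  exact (Finset.mem_filter.1 hF).1

/-- An interface belongs to exactly two cells, and these have opposite normals. -/
theorem cellsAt_interface [DecidableEq M.Cell] (hd : 0 < d) {F : Finset (Vec d)}
    (hF : F ∈ M.interfaces) :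
    ∃ T₁ T₂ : M.Cell, T₁ ≠ T₂ ∧ M.cellsAt F = {T₁, T₂} ∧
      outerNormal T₂.1 F = - outerNormal T₁.1 F := by
  classical
  have hFc := card_of_mem_facets M (mem_facets_of_mem_interfaces M hF)
  obtain ⟨-, T₁, h₁, T₂, h₂, hne, hF₁, hF₂⟩ := Finset.mem_filter.1 hF
  have h12 := outerNormal_eq_neg M hd h₁ h₂ hne hF₁ hF₂ hFc
  refine ⟨⟨T₁, h₁⟩, ⟨T₂, h₂⟩, fun h => hne (congrArg Subtype.val h), ?_, h12⟩
  ext ⟨T₃, h₃⟩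
  simp only [Triangulation.cellsAt, Finset.mem_filter, Finset.mem_univ, true_and,
    Finset.mem_insert, Finset.mem_singleton, Subtype.mk.injEq]
  constructor
  -- The normal of a third cell would be opposite to both `ν` and `-ν`, which forces `ν = 0`.
  · intro hF₃
    by_contra! hc
    have h13 := outerNormal_eq_neg M hd h₁ h₃ hc.1.symm hF₁ hF₃ hFc
    have h23 := outerNormal_eq_neg M hd h₂ h₃ hc.2.symm hF₂ hF₃ hFc
    obtain ⟨q, hq, hFq⟩ := exists_erase_eq (M.card_eq T₁ h₁) hF₁ hFc
    have hn := norm_outerNormal (M.affineIndependent T₁ h₁) hq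
      (hFq ▸ Finset.card_pos.1 (by omega))
    rw [← hFq] at hn
    rw [h13, h12, neg_neg] at h23
    have : outerNormal T₁ F = 0 := by
      have h := add_eq_zero_iff_neg_eq.2 h23
      rw [← two_smul ℝ] at h
      exact (smul_eq_zero.1 h).resolve_left two_ne_zero
    rw [this, norm_zero] at hn
    exact zero_ne_one hn
  · rintro (rfl | rfl) <;> assumption

/-- With opposite normals this is the identity `a₁ b₁ - a₂ b₂ = (b₁ - b₂) {a} + (a₁ - a₂) {b}`,
where `b` is the normal component of `w`. -/
theorem sum_inner_interface (hd : 0 < d) {F : Finset (Vec d)} (hF : F ∈ M.interfaces)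
    (a : Broken M ℝ) (w : Broken M (Vec d)) (x : Vec d) :
    ∑ T ∈ M.cellsAt F, inner ℝ (a T x • w T x) (outerNormal T.1 F) =
      jumpV w F x * avg a F x + inner ℝ (jump a F x) (avg w F x) := by
  classical
  obtain ⟨T₁, T₂, hne, hc, hn⟩ := cellsAt_interface M hd hF
  rw [jumpV, avg, avg, jump, hc, Finset.card_pair hne]
  simp only [Finset.sum_pair hne, hn, inner_add_left, inner_add_right, real_inner_smul_left,
    real_inner_smul_right, inner_neg_right, inner_neg_left, smul_neg, smul_eq_mul]
  rw [real_inner_comm (w T₁ x), real_inner_comm (w T₂ x)]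
  push_cast
  ring

/-- The facets of a cell correspond to its vertices. This turns the vertex sum of the divergence
theorem into a facet sum that can be exchanged with the sum over cells. -/
theorem sum_erase_eq_sum_facets [DecidableEq (Vec d)] (T : M.Cell) (f : Finset (Vec d) → ℝ) :
    ∑ v ∈ T.1, f (T.1.erase v) = ∑ F ∈ M.facets.filter (fun F => F ⊆ T.1), f F := by
  have h : M.facets.filter (fun F => F ⊆ T.1) = T.1.image fun v => T.1.erase v := by
    ext F
    simp only [Finset.mem_filter, Finset.mem_image]
    constructor
    · rintro ⟨hF, hFT⟩
      obtain ⟨q, hq, rfl⟩ := exists_erase_eq (M.card_eq T.1 T.2) hFT (card_of_mem_facets M hF)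
      exact ⟨q, hq, rfl⟩
    · rintro ⟨v, hv, rfl⟩
      refine ⟨?_, Finset.erase_subset _ _⟩
      exact (mem_facets M).2 ⟨T.1, T.2, Finset.erase_subset _ _, by
        rw [Finset.card_erase_of_mem hv, M.card_eq T.1 T.2]; rfl⟩
  rw [h, Finset.sum_image]
  exact Finset.erase_injOn T.1

variable {M}

/-- Piecewise integration by parts: the product rule for jumps and averages on the interfaces,
when the normal traces vanish on the boundary faces. -/
theorem domainIntegral_divergence_smul (hd : 0 < d) (hΩ : interior (closure Ω) = Ω)
    {a : Broken M ℝ} {w : Broken M (Vec d)} (ha : ∀ T, ContDiff ℝ 1 (a T))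
    (hw : ∀ T, ContDiff ℝ 1 (w T))
    (hbd : ∀ F ∈ M.boundaryFaces, ∀ T ∈ M.cellsAt F,
      ∀ x ∈ convexHull ℝ (F : Set (Vec d)), inner ℝ (w T x) (outerNormal T.1 F) = 0) :
    domainIntegral (M := M) (fun T x => divergence (fun y => a T y • w T y) x) =
      interfaceIntegral M (fun F x =>
        jumpV w F x * avg a F x + inner ℝ (jump a F x) (avg w F x)) := by
  classical
  have hcont : ∀ (T : M.Cell) (F : Finset (Vec d)),
      Continuous fun x => inner ℝ (a T x • w T x) (outerNormal T.1 F) := fun T F =>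
    ((ha T).continuous.smul (hw T).continuous).inner continuous_const
  calc _ = ∑ T : M.Cell, ∑ F ∈ M.facets.filter (fun F => F ⊆ T.1),
        faceIntegral F (fun x => inner ℝ (a T x • w T x) (outerNormal T.1 F)) := by
        refine Finset.sum_congr rfl fun T _ => ?_
        refine (integral_divergence_cell hd (M.affineIndependent T.1 T.2) (M.card_eq T.1 T.2)
          ((ha T).smul (hw T))).trans ?_
        exact sum_erase_eq_sum_facets M T fun F =>
          faceIntegral F (fun x => inner ℝ (a T x • w T x) (outerNormal T.1 F))
    _ = ∑ F ∈ M.facets, ∑ T ∈ M.cellsAt F,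
        faceIntegral F (fun x => inner ℝ (a T x • w T x) (outerNormal T.1 F)) := by
        simp only [Triangulation.cellsAt, Finset.sum_filter]
        exact Finset.sum_comm
    _ = ∑ F ∈ M.facets, faceIntegral F
        (fun x => ∑ T ∈ M.cellsAt F, inner ℝ (a T x • w T x) (outerNormal T.1 F)) := by
        refine Finset.sum_congr rfl fun F hF => ?_
        rw [faceIntegral_sum hd (card_of_mem_facets M hF) _ fun T _ => hcont T F]
    _ = ∑ F ∈ M.interfaces, faceIntegral F
        (fun x => ∑ T ∈ M.cellsAt F, inner ℝ (a T x • w T x) (outerNormal T.1 F)) := by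
        -- A facet that is not an interface is a boundary face, where the normal trace vanishes.
        refine (Finset.sum_subset (fun F hF => mem_facets_of_mem_interfaces M hF) ?_).symm
        intro F hF hFi
        have hb := mem_boundaryFaces_of_notMem_interfaces M hd hΩ hF hFi
        rw [faceIntegral_congr (h := fun _ => 0)]
        · simp [faceIntegral]
        · intro x hx
          refine Finset.sum_eq_zero fun T hT => ?_
          rw [real_inner_smul_left, hbd F hb T hT x hx, mul_zero]
    _ = _ := by
        refine Finset.sum_congr rfl fun F hF => ?_
        exact faceIntegral_congr fun x _ => sum_inner_interface M hd hF a w x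

end Skeleton

/-! ### Curves in finite-dimensional spaces of broken functions -/

section Curves

/-- A curve in a finite-dimensional space is differentiable once it is so along a separating family
of functionals. -/
theorem exists_hasDerivAt_of_separating {V : Type*} [AddCommGroup V] [Module ℝ V]
    [FiniteDimensional ℝ V] {ι : Type*} (ev : ι → V →ₗ[ℝ] ℝ)
    (hsep : ∀ v, (∀ i, ev i v = 0) → v = 0) {u : ℝ → V} {t : ℝ}
    (hu : ∀ i, DifferentiableAt ℝ (fun s => ev i (u s)) t) :
    ∃ u' : V, ∀ {G : Type} [NormedAddCommGroup G] [NormedSpace ℝ G] (l : V →ₗ[ℝ] G),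
      HasDerivAt (fun s => l (u s)) (l u') t := by
  have hall : ∀ f : V →ₗ[ℝ] ℝ, DifferentiableAt ℝ (fun s => f (u s)) t := by
    intro f
    -- In finite dimension a separating family spans the dual space.
    have hf : f ∈ Submodule.span ℝ (range ev) := by
      refine FiniteDimensional.mem_span_of_iInf_ker_le_ker fun v hv => ?_
      rw [Submodule.mem_iInf] at hv
      rw [hsep v fun i => hv i]
      exact Submodule.zero_mem _
    induction hf using Submodule.span_induction with
    | mem f h => obtain ⟨i, rfl⟩ := h; exact hu i
    | zero => exact differentiableAt_const 0
    | add f g _ _ hf hg => exact hf.add hg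
    | smul c f _ hf => exact hf.const_smul c
  let B := Module.finBasis ℝ V
  refine ⟨∑ j, deriv (fun s => B.coord j (u s)) t • B j, fun {G} _ _ l => ?_⟩
  have h : (fun s => l (u s)) = fun s => ∑ j, B.coord j (u s) • l (B j) := by
    ext1 s
    conv_lhs => rw [← B.sum_repr (u s), map_sum]
    simp
  rw [h, map_sum]
  refine HasDerivAt.fun_sum fun j _ => ?_
  rw [map_smul]
  exact (hall (B.coord j)).hasDerivAt.smul_const (l (B j))

variable {d : ℕ} {Ω : Set (Vec d)} {M : Triangulation d Ω} {E : Type} [NormedAddCommGroup E]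
  [NormedSpace ℝ E]

/-- The time derivative of a curve of broken functions in a finite-dimensional space belongs to the
space, and commutes with all linear functionals. -/
theorem hasDerivAt_of_pointwise (W : Submodule ℝ (Broken M E)) [FiniteDimensional ℝ W]
    {u : ℝ → Broken M E} {t : ℝ} (hW : ∀ᶠ s in nhds t, u s ∈ W)
    (hu : ∀ T x, DifferentiableAt ℝ (fun s => u s T x) t) :
    (fun T x => deriv (fun s => u s T x) t) ∈ W ∧
    ∀ {G : Type} [NormedAddCommGroup G] [NormedSpace ℝ G] (l : Broken M E → G)
      (_ : ∀ a ∈ W, ∀ b ∈ W, l (a + b) = l a + l b) (_ : ∀ (c : ℝ), ∀ a ∈ W, l (c • a) = c • l a),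
      HasDerivAt (fun s => l (u s)) (l fun T x => deriv (fun s => u s T x) t) t := by
  classical
  let ev : M.Cell × Vec d × (E →L[ℝ] ℝ) → W →ₗ[ℝ] ℝ := fun i =>
    { toFun := fun w => i.2.2 (w.1 i.1 i.2.1)
      map_add' := fun a b => by simp
      map_smul' := fun c a => by simp }
  -- The curve lies in `W` only for times near `t`; the value `0` elsewhere does not affect the
  -- derivative.
  let U : ℝ → W := fun s => if h : u s ∈ W then ⟨u s, h⟩ else 0
  have hU : ∀ᶠ s in nhds t, (U s : Broken M E) = u s := by
    filter_upwards [hW] with s hs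
    simp [U, hs]
  obtain ⟨u', hu'⟩ := exists_hasDerivAt_of_separating ev
    (fun w hw => by
      ext1; funext T x
      exact (SeparatingDual.eq_zero_of_forall_dual_eq_zero (R := ℝ) fun f => hw (T, x, f)))
    (u := U) (t := t) (fun i => by
      refine (((i.2.2).differentiableAt).comp t (hu i.1 i.2.1)).congr_of_eventuallyEq ?_
      filter_upwards [hU] with s hs
      simp [ev, hs])
  have key : ∀ {G : Type} [NormedAddCommGroup G] [NormedSpace ℝ G] (l : Broken M E → G)
      (_ : ∀ a ∈ W, ∀ b ∈ W, l (a + b) = l a + l b) (_ : ∀ (c : ℝ), ∀ a ∈ W, l (c • a) = c • l a),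
      HasDerivAt (fun s => l (u s)) (l u') t := by
    intro G _ _ l hadd hsmul
    let L : W →ₗ[ℝ] G :=
      { toFun := fun w => l w
        map_add' := fun a b => hadd a a.2 b b.2
        map_smul' := fun c a => hsmul c a a.2 }
    refine (hu' L).congr_of_eventuallyEq ?_
    filter_upwards [hU] with s hs
    simp [L, hs]
  -- Point evaluations are linear, so the abstract derivative has the pointwise derivatives as its
  -- values.
  have heq : (fun T x => deriv (fun s => u s T x) t) = (u' : Broken M E) := by
    funext T x
    exact (key (fun a => a T x) (fun _ _ _ _ => rfl) (fun _ _ _ => rfl)).deriv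
  rw [heq]
  exact ⟨u'.2, key⟩

/-- A differentiable curve of continuous broken functions is Lipschitz at a point, uniformly on
compact sets. -/
theorem exists_uniform_lipschitz (W : Submodule ℝ (Broken M E)) [FiniteDimensional ℝ W]
    (hWc : ∀ a ∈ W, ∀ T, Continuous (a T))
    {u : ℝ → Broken M E} {t : ℝ} (hW : ∀ᶠ s in nhds t, u s ∈ W)
    (hu : ∀ T x, DifferentiableAt ℝ (fun s => u s T x) t) (T : M.Cell) {K : Set (Vec d)}
    (hK : IsCompact K) :
    ∃ C > 0, ∀ᶠ s in nhds t, ∀ x ∈ K, ‖u s T x - u t T x‖ ≤ C * |s - t| := by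
  classical
  have : CompactSpace K := isCompact_iff_compactSpace.1 hK
  -- Restriction to `K` with the supremum norm: differentiability in this norm is what makes the
  -- Lipschitz bound uniform in `x`. The default `0` destroys linearity only outside `W`.
  let l : Broken M E → C(K, E) := fun a =>
    if h : Continuous (a T) then ⟨fun x => a T x, h.comp continuous_subtype_val⟩ else 0
  have hl : ∀ a ∈ W, ∀ x : K, l a x = a T x := fun a ha x => by simp [l, hWc a ha T]
  have hd := (hasDerivAt_of_pointwise W hW hu).2 l
    (fun a ha b hb => by
      ext x
      simp [hl _ ha, hl _ hb, hl _ (W.add_mem ha hb)])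
    (fun c a ha => by
      ext x
      simp [hl _ ha, hl _ (W.smul_mem c ha)])
  obtain ⟨C, hC, hb⟩ := hd.isBigO_sub.exists_pos
  refine ⟨C, hC, ?_⟩
  filter_upwards [hb.bound, hW] with s hs hsW x hx
  have h1 := ((l (u s) - l (u t)).norm_coe_le_norm ⟨x, hx⟩).trans hs
  rwa [ContinuousMap.sub_apply, hl _ hsW, hl _ hW.self_of_nhds, Real.norm_eq_abs] at h1

/-- Differentiation under the integral sign for the composition of a Lipschitz function with a
curve of functions that is uniformly Lipschitz at a point. -/
theorem hasDerivAt_integral_comp {F : Type*} [NormedAddCommGroup F] {K : Set (Vec d)}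
    (hK : IsCompact K) {G : F → ℝ} {S : Set F} {L : NNReal} (hG : LipschitzOnWith L G S)
    {q : ℝ → Vec d → F} {t : ℝ} (hqS : ∀ᶠ s in nhds t, ∀ x ∈ K, q s x ∈ S)
    (hqc : ∀ᶠ s in nhds t, ContinuousOn (q s) K)
    {C : ℝ} (hql : ∀ᶠ s in nhds t, ∀ x ∈ K, ‖q s x - q t x‖ ≤ C * |s - t|)
    {g' : Vec d → ℝ} (hg' : ContinuousOn g' K)
    (hd : ∀ x ∈ K, HasDerivAt (fun s => G (q s x)) (g' x) t) :
    HasDerivAt (fun s => ∫ x in K, G (q s x)) (∫ x in K, g' x) t := by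
  have hev := (hqS.and hqc).and hql
  have hcont : ∀ s, (∀ x ∈ K, q s x ∈ S) → ContinuousOn (q s) K →
      ContinuousOn (fun x => G (q s x)) K := fun s h1 h2 => hG.continuousOn.comp h2 h1
  have hg'i : IntegrableOn g' K := hg'.integrableOn_compact hK
  have h := (hasFDerivAt_integral_of_dominated_loc_of_lip' (𝕜 := ℝ) (μ := volume.restrict K)
    (F := fun s x => G (q s x)) (F' := fun x => ContinuousLinearMap.toSpanSingleton ℝ (g' x))
    (x₀ := t) (bound := fun _ => L * C) hev
    (fun s hs => (hcont s hs.1.1 hs.1.2).aestronglyMeasurable hK.measurableSet)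
    ((hcont t hqS.self_of_nhds hqc.self_of_nhds).integrableOn_compact hK)
    ((ContinuousLinearMap.toSpanSingletonCLE (𝕜 := ℝ) (E := ℝ)).continuous.comp_aestronglyMeasurable
      hg'i.aestronglyMeasurable)
    (ae_restrict_of_forall_mem hK.measurableSet fun x hx s hs => ?_)
    (integrableOn_const hK.measure_lt_top.ne)
    (ae_restrict_of_forall_mem hK.measurableSet fun x hx => (hd x hx).hasFDerivAt)).2
  · have h2 := h.hasDerivAt
    rw [ContinuousLinearMap.integral_apply] at h2
    · simpa using h2
    · exact (ContinuousLinearMap.toSpanSingletonCLE (𝕜 := ℝ) (E := ℝ)).toContinuousLinearMap.integrable_comp hg'i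
  · calc _ ≤ L * ‖q s x - q t x‖ := hG.norm_sub_le (hs.1.1 x hx) (hqS.self_of_nhds x hx)
      _ ≤ L * (C * |s - t|) := by gcongr; exact hs.2 x hx
      _ = _ := by rw [Real.norm_eq_abs]; ring

end Curves

/-! ### The discrete spaces -/

section Spaces

variable {d : ℕ} {Ω : Set (Vec d)} (M : Triangulation d Ω) (k : ℕ)

/-- `V_h` as a linear space. -/
def VhSubmodule : Submodule ℝ (Broken M ℝ) where
  carrier := Vh M k
  zero_mem' T := ⟨0, by simp, by simp⟩
  add_mem' := by
    intro a b ha hb T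
    obtain ⟨p, hp, hpe⟩ := ha T
    obtain ⟨q, hq, hqe⟩ := hb T
    exact ⟨p + q, (MvPolynomial.totalDegree_add p q).trans (max_le hp hq), fun x => by
      simp [hpe, hqe]⟩
  smul_mem' := by
    intro c a ha T
    obtain ⟨p, hp, hpe⟩ := ha T
    exact ⟨c • p, (MvPolynomial.totalDegree_smul_le c p).trans hp, fun x => by simp [hpe]⟩

/-- `(V_h)^d` as a linear space. -/
def VhVecSubmodule : Submodule ℝ (Broken M (Vec d)) where
  carrier := VhVec M k
  zero_mem' _ := (VhSubmodule M k).zero_mem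
  add_mem' ha hb i := (VhSubmodule M k).add_mem (ha i) (hb i)
  smul_mem' c _ ha i := (VhSubmodule M k).smul_mem c (ha i)

/-- The space is the image of the tuples of polynomials of bounded degree, one for each cell. -/
instance : FiniteDimensional ℝ (VhSubmodule M k) := by
  let l : (M.Cell → MvPolynomial.restrictTotalDegree (Fin d) ℝ k) →ₗ[ℝ] VhSubmodule M k :=
    { toFun := fun p => ⟨fun T x => MvPolynomial.eval (⇑x) (p T).1, fun T =>
        ⟨(p T).1, (MvPolynomial.mem_restrictTotalDegree _ _ _).1 (p T).2, fun _ => rfl⟩⟩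
      map_add' := fun p q => by ext T x; simp
      map_smul' := fun c p => by ext T x; simp }
  refine Module.Finite.of_surjective l ?_
  rintro ⟨u, hu⟩
  have h : ∀ T, IsPolyLE k (u T) := hu
  choose p hp hpe using h
  refine ⟨fun T => ⟨p T, (MvPolynomial.mem_restrictTotalDegree _ _ _).2 (hp T)⟩, ?_⟩
  ext T x
  exact (hpe T x).symm

instance : FiniteDimensional ℝ (VhVecSubmodule M k) := by
  let l : VhVecSubmodule M k →ₗ[ℝ] (Fin d → VhSubmodule M k) :=
    { toFun := fun w i => ⟨fun T x => w.1 T x i, w.2 i⟩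
      map_add' := fun p q => rfl
      map_smul' := fun c p => rfl }
  refine Module.Finite.of_injective l ?_
  intro w w' h
  ext T x i
  exact congrFun (congrFun (congrArg Subtype.val (congrFun h i)) T) x

variable {M k}

theorem contDiff_of_isPolyLE {g : Vec d → ℝ} (hg : IsPolyLE k g) {n : WithTop ℕ∞} :
    ContDiff ℝ n g := by
  obtain ⟨p, -, hp⟩ := hg
  have : g = fun x : Vec d => ∑ m ∈ p.support, p.coeff m * ∏ i, x i ^ m i := by
    ext x; rw [hp, MvPolynomial.eval_eq']
  rw [this]
  fun_prop

theorem contDiff_of_mem_Vh {a : Broken M ℝ} (ha : a ∈ Vh M k) (T : M.Cell) {n : WithTop ℕ∞} :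
    ContDiff ℝ n (a T) := contDiff_of_isPolyLE (ha T)

theorem contDiff_of_mem_VhVec {w : Broken M (Vec d)} (hw : w ∈ VhVec M k) (T : M.Cell)
    {n : WithTop ℕ∞} : ContDiff ℝ n (w T) :=
  contDiff_euclidean.2 fun i => contDiff_of_isPolyLE (hw i T)

end Spaces

/-! ### The time derivative of the energy -/

namespace Model

variable (D : Model)

/-- The state region of the free energy. -/
def region : Set (ℝ × ℝ) := Ioi 0 ×ˢ Icc 0 1

theorem uniqueDiffOn_region : UniqueDiffOn ℝ region :=
  isOpen_Ioi.uniqueDiffOn.prod (uniqueDiffOn_Icc zero_lt_one)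

theorem contDiffOn_energyDensity :
    ContDiffOn ℝ 1 (fun p : ℝ × ℝ => p.1 * D.f p.1 p.2) region :=
  contDiff_fst.contDiffOn.mul D.f_contDiffOn

theorem hasFDerivWithinAt_energyDensity {p : ℝ × ℝ} (hp : p ∈ region) :
    HasFDerivWithinAt (fun p : ℝ × ℝ => p.1 * D.f p.1 p.2)
      (fderivWithin ℝ (fun p : ℝ × ℝ => p.1 * D.f p.1 p.2) region p) region p :=
  (D.contDiffOn_energyDensity.differentiableOn one_ne_zero p hp).hasFDerivWithinAt

/-- The region is open in the `ρ` direction, so the ordinary derivative is a directional value of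
the joint derivative within the region. For `φ` the one-sided derivative plays this part. -/
theorem dρ_eq {p : ℝ × ℝ} (hp : p ∈ region) :
    D.dρ p.1 p.2 = fderivWithin ℝ (fun p : ℝ × ℝ => p.1 * D.f p.1 p.2) region p (1, 0) := by
  have h1 : HasDerivWithinAt (fun r : ℝ => (r, p.2)) (1, 0) (Ioi 0) p.1 :=
    ((hasDerivAt_id p.1).prodMk (hasDerivAt_const p.1 p.2)).hasDerivWithinAt
  have h2 := (D.hasFDerivWithinAt_energyDensity hp).comp_hasDerivWithinAt (f := fun r => (r, p.2))
    p.1 h1 fun r hr => ⟨hr, hp.2⟩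
  exact (h2.hasDerivAt (isOpen_Ioi.mem_nhds hp.1)).deriv

theorem dφ_eq {p : ℝ × ℝ} (hp : p ∈ region) :
    D.dφ p.1 p.2 = fderivWithin ℝ (fun p : ℝ × ℝ => p.1 * D.f p.1 p.2) region p (0, 1) := by
  have h1 : HasDerivWithinAt (fun s : ℝ => (p.1, s)) (0, 1) (Icc 0 1) p.2 :=
    ((hasDerivAt_const p.2 p.1).prodMk (hasDerivAt_id p.2)).hasDerivWithinAt
  have h2 := (D.hasFDerivWithinAt_energyDensity hp).comp_hasDerivWithinAt (f := fun s => (p.1, s))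
    p.2 h1 fun r hr => ⟨hp.1, hr⟩
  exact h2.derivWithin (uniqueDiffOn_Icc zero_lt_one p.2 hp.2)

theorem continuousOn_fderivWithin_energyDensity (v : ℝ × ℝ) :
    ContinuousOn (fun p => fderivWithin ℝ (fun p : ℝ × ℝ => p.1 * D.f p.1 p.2) region p v)
      region :=
  (D.contDiffOn_energyDensity.continuousOn_fderivWithin uniqueDiffOn_region le_rfl).clm_apply
    continuousOn_const

theorem continuousOn_dρ : ContinuousOn (fun p : ℝ × ℝ => D.dρ p.1 p.2) region :=
  (D.continuousOn_fderivWithin_energyDensity (1, 0)).congr fun _ hp => D.dρ_eq hp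

theorem continuousOn_dφ : ContinuousOn (fun p : ℝ × ℝ => D.dφ p.1 p.2) region :=
  (D.continuousOn_fderivWithin_energyDensity (0, 1)).congr fun _ hp => D.dφ_eq hp

/-- The chain rule along curves in the state region. -/
theorem hasDerivAt_energyDensity {r p : ℝ → ℝ} {r' p' t : ℝ} (hr : HasDerivAt r r' t)
    (hp : HasDerivAt p p' t) (hreg : ∀ᶠ s in nhds t, (r s, p s) ∈ region) :
    HasDerivAt (fun s => r s * D.f (r s) (p s))
      (D.dρ (r t) (p t) * r' + D.dφ (r t) (p t) * p') t := by
  have ht := hreg.self_of_nhds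
  -- The joint derivative exists only within the region. The times at which the curve lies in the
  -- region form a neighbourhood of `t`, so the composition still has a two-sided derivative.
  have h1 : HasDerivWithinAt (fun s => (r s, p s)) (r', p') {s | (r s, p s) ∈ region} t :=
    (hr.prodMk hp).hasDerivWithinAt
  have h2 := ((D.hasFDerivWithinAt_energyDensity ht).comp_hasDerivWithinAt
    (f := fun s => (r s, p s)) t h1 fun s hs => hs).hasDerivAt hreg
  refine h2.congr_deriv ?_
  rw [D.dρ_eq ht, D.dφ_eq ht]
  have : (r', p') = r' • ((1 : ℝ), (0 : ℝ)) + p' • ((0 : ℝ), (1 : ℝ)) := by simp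
  rw [this, map_add, map_smul, map_smul, smul_eq_mul, smul_eq_mul]
  ring

variable {d : ℕ}

/-- The integrand of the energy as a function of `(ρ, φ, σ, v)`. -/
def totalDensity (p : (ℝ × ℝ) × (Vec d × Vec d)) : ℝ :=
  p.1.1 * D.f p.1.1 p.1.2 + D.γ / 2 * ‖p.2.1‖ ^ 2 + p.1.1 / 2 * ‖p.2.2‖ ^ 2

theorem contDiffOn_totalDensity :
    ContDiffOn ℝ 1 (D.totalDensity (d := d)) (region ×ˢ univ) := by
  have h1 : ContDiffOn ℝ 1 (fun p : (ℝ × ℝ) × (Vec d × Vec d) => p.1.1 * D.f p.1.1 p.1.2)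
      (region ×ˢ univ) :=
    D.contDiffOn_energyDensity.comp contDiff_fst.contDiffOn fun p hp => hp.1
  have h2 : ContDiff ℝ 1 fun p : (ℝ × ℝ) × (Vec d × Vec d) => D.γ / 2 * ‖p.2.1‖ ^ 2 :=
    contDiff_const.mul ((contDiff_fst.comp contDiff_snd).norm_sq ℝ)
  have h3 : ContDiff ℝ 1 fun p : (ℝ × ℝ) × (Vec d × Vec d) => p.1.1 / 2 * ‖p.2.2‖ ^ 2 :=
    ((contDiff_fst.comp contDiff_fst).div_const 2).mul ((contDiff_snd.comp contDiff_snd).norm_sq ℝ)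
  exact (h1.add h2.contDiffOn).add h3.contDiffOn

/-- On a compact set the derivative within the region is bounded; convexity turns the bound into a
Lipschitz constant by the mean value inequality. -/
theorem exists_lipschitzOnWith_totalDensity {C : Set ((ℝ × ℝ) × (Vec d × Vec d))}
    (hC : IsCompact C) (hconv : Convex ℝ C) (hsub : C ⊆ region ×ˢ univ) :
    ∃ L, LipschitzOnWith L D.totalDensity C := by
  have hcd := D.contDiffOn_totalDensity (d := d)
  have hu : UniqueDiffOn ℝ ((region : Set (ℝ × ℝ)) ×ˢ (univ : Set (Vec d × Vec d))) :=
    uniqueDiffOn_region.prod uniqueDiffOn_univ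
  obtain ⟨B, hB⟩ := hC.exists_bound_of_continuousOn
    ((hcd.continuousOn_fderivWithin hu le_rfl).mono hsub)
  refine ⟨B.toNNReal, hconv.lipschitzOnWith_of_nnnorm_hasFDerivWithin_le (𝕜 := ℝ)
    (fun p hp => ((hcd.differentiableOn one_ne_zero p (hsub hp)).hasFDerivWithinAt).mono hsub)
    fun p hp => ?_⟩
  exact NNReal.coe_le_coe.1 ((hB p hp).trans (Real.le_coe_toNNReal B))

end Model

/-! ### Differentiability of the energy along a discrete solution -/

section Energy

variable {d : ℕ} {Ω : Set (Vec d)} {M : Triangulation d Ω} {k : ℕ} {D : Model} {αB : ℝ}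
  {Fl : Fluxes M} {t₁ : ℝ} {U : ℝ → State M}

/-- The integrand of the time derivative of the energy. -/
def energyRate (D : Model) (U : ℝ → State M) (t : ℝ) : Broken M ℝ := fun T x =>
  D.dρ ((U t).ρ T x) ((U t).φ T x) * deriv (fun s => (U s).ρ T x) t
    + D.dφ ((U t).ρ T x) ((U t).φ T x) * deriv (fun s => (U s).φ T x) t
    + D.γ * inner ℝ (deriv (fun s => (U s).σ T x) t) ((U t).σ T x)
    + 1 / 2 * ‖(U t).v T x‖ ^ 2 * deriv (fun s => (U s).ρ T x) t
    + (U t).ρ T x * inner ℝ (deriv (fun s => (U s).v T x) t) ((U t).v T x)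

namespace IsSemiDiscrete

variable (hU : IsSemiDiscrete D k αB Fl t₁ U) {t : ℝ} (ht : t ∈ Ioo 0 t₁)
include hU ht

theorem eventually_mem : ∀ᶠ s in nhds t, U s ∈ StateSpace M k := by
  filter_upwards [Icc_mem_nhds ht.1 ht.2] with s hs using hU.mem s hs

theorem differentiableAt_ρ (T : M.Cell) (x : Vec d) :
    DifferentiableAt ℝ (fun s => (U s).ρ T x) t :=
  (hU.diff_ρ T x).differentiableAt (Icc_mem_nhds ht.1 ht.2)

theorem differentiableAt_v (T : M.Cell) (x : Vec d) :
    DifferentiableAt ℝ (fun s => (U s).v T x) t :=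
  (hU.diff_v T x).differentiableAt (Icc_mem_nhds ht.1 ht.2)

theorem differentiableAt_φ (T : M.Cell) (x : Vec d) :
    DifferentiableAt ℝ (fun s => (U s).φ T x) t :=
  (hU.diff_φ T x).differentiableAt (Icc_mem_nhds ht.1 ht.2)

theorem differentiableAt_σ (T : M.Cell) (x : Vec d) :
    DifferentiableAt ℝ (fun s => (U s).σ T x) t :=
  (hU.diff_σ T x).differentiableAt (Icc_mem_nhds ht.1 ht.2)

/-- The time derivatives of `ρ` and `φ` serve as test functions in the equations for `τ` and `μ`, so
they have to belong to `V_h`. -/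
theorem deriv_ρ_mem : (fun T x => deriv (fun s => (U s).ρ T x) t) ∈ Vh M k :=
  (hasDerivAt_of_pointwise (VhSubmodule M k) (u := fun s => (U s).ρ)
    ((hU.eventually_mem ht).mono fun _ h => h.1) (hU.differentiableAt_ρ ht)).1

theorem deriv_φ_mem : (fun T x => deriv (fun s => (U s).φ T x) t) ∈ Vh M k :=
  (hasDerivAt_of_pointwise (VhSubmodule M k) (u := fun s => (U s).φ)
    ((hU.eventually_mem ht).mono fun _ h => h.2.2.1) (hU.differentiableAt_φ ht)).1

theorem deriv_v_mem : (fun T x => deriv (fun s => (U s).v T x) t) ∈ VhVec M k :=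
  (hasDerivAt_of_pointwise (VhVecSubmodule M k) (u := fun s => (U s).v)
    ((hU.eventually_mem ht).mono fun _ h => h.2.1.1) (hU.differentiableAt_v ht)).1

theorem deriv_σ_mem : (fun T x => deriv (fun s => (U s).σ T x) t) ∈ VhVec M k :=
  (hasDerivAt_of_pointwise (VhVecSubmodule M k) (u := fun s => (U s).σ)
    ((hU.eventually_mem ht).mono fun _ h => h.2.2.2.2.2.1) (hU.differentiableAt_σ ht)).1

theorem continuousOn_dρ (T : M.Cell) :
    ContinuousOn (fun x => D.dρ ((U t).ρ T x) ((U t).φ T x))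
      (convexHull ℝ (T.1 : Set (Vec d))) := by
  have hm := hU.mem t (Ioo_subset_Icc_self ht)
  have hc : Continuous fun x => ((U t).ρ T x, (U t).φ T x) :=
    (contDiff_of_mem_Vh hm.1 T (n := 0)).continuous.prodMk
      (contDiff_of_mem_Vh hm.2.2.1 T (n := 0)).continuous
  exact D.continuousOn_dρ.comp hc.continuousOn fun x hx =>
    ⟨hU.ρ_pos t (Ioo_subset_Icc_self ht) T x hx, hU.φ_mem t (Ioo_subset_Icc_self ht) T x hx⟩

theorem continuousOn_dφ (T : M.Cell) :
    ContinuousOn (fun x => D.dφ ((U t).ρ T x) ((U t).φ T x))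
      (convexHull ℝ (T.1 : Set (Vec d))) := by
  have hm := hU.mem t (Ioo_subset_Icc_self ht)
  have hc : Continuous fun x => ((U t).ρ T x, (U t).φ T x) :=
    (contDiff_of_mem_Vh hm.1 T (n := 0)).continuous.prodMk
      (contDiff_of_mem_Vh hm.2.2.1 T (n := 0)).continuous
  exact D.continuousOn_dφ.comp hc.continuousOn fun x hx =>
    ⟨hU.ρ_pos t (Ioo_subset_Icc_self ht) T x hx, hU.φ_mem t (Ioo_subset_Icc_self ht) T x hx⟩

/-- On each cell and for times near `t` the states stay in one compact convex set, where the density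
is Lipschitz. The curves are uniformly Lipschitz at `t`, so dominated convergence applies. -/
theorem hasDerivAt_energy :
    HasDerivAt (fun s => D.energy (U s)) (domainIntegral (energyRate D U t)) t := by
  refine HasDerivAt.fun_sum fun T _ => ?_
  have htI := Ioo_subset_Icc_self ht
  have hIcc : Icc 0 t₁ ∈ nhds t := Icc_mem_nhds ht.1 ht.2
  have hm := hU.mem t htI
  have hev := hU.eventually_mem ht
  set K := convexHull ℝ (T.1 : Set (Vec d)) with hKdef
  have hK : IsCompact K := isCompact_convexHull_finset T.1
  have hcS : ∀ a ∈ VhSubmodule M k, ∀ T, Continuous (a T) := fun a ha T =>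
    (contDiff_of_mem_Vh ha T (n := 0)).continuous
  have hcV : ∀ a ∈ VhVecSubmodule M k, ∀ T, Continuous (a T) := fun a ha T =>
    (contDiff_of_mem_VhVec ha T (n := 0)).continuous
  obtain ⟨Cρ, hCρ, hρ⟩ := exists_uniform_lipschitz (VhSubmodule M k) hcS (u := fun s => (U s).ρ)
    (hev.mono fun _ h => h.1) (hU.differentiableAt_ρ ht) T hK
  obtain ⟨Cφ, hCφ, hφ⟩ := exists_uniform_lipschitz (VhSubmodule M k) hcS (u := fun s => (U s).φ)
    (hev.mono fun _ h => h.2.2.1) (hU.differentiableAt_φ ht) T hK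
  obtain ⟨Cσ, hCσ, hσ⟩ := exists_uniform_lipschitz (VhVecSubmodule M k) hcV
    (u := fun s => (U s).σ) (hev.mono fun _ h => h.2.2.2.2.2.1) (hU.differentiableAt_σ ht) T hK
  obtain ⟨Cv, hCv, hv⟩ := exists_uniform_lipschitz (VhVecSubmodule M k) hcV
    (u := fun s => (U s).v) (hev.mono fun _ h => h.2.1.1) (hU.differentiableAt_v ht) T hK
  have hcρ := hcS _ hm.1 T
  have hcφ := hcS _ hm.2.2.1 T
  have hcσ := hcV _ hm.2.2.2.2.2.1 T
  have hcv := hcV _ hm.2.1.1 T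
  have hKne : K.Nonempty := convexHull_nonempty_iff.2 (Finset.coe_nonempty.2
    (Finset.card_pos.1 (by rw [M.card_eq T.1 T.2]; omega)))
  -- Compactness gives `ρ` a positive minimum on the closed cell, which keeps nearby states away
  -- from the singular value `0`.
  obtain ⟨x₀, hx₀, hmin⟩ := hK.exists_isMinOn hKne hcρ.continuousOn
  have ha : 0 < (U t).ρ T x₀ := hU.ρ_pos t htI T x₀ hx₀
  set a := (U t).ρ T x₀
  obtain ⟨R₁, hR₁⟩ := hK.exists_bound_of_continuousOn hcρ.continuousOn
  obtain ⟨R₂, hR₂⟩ := hK.exists_bound_of_continuousOn hcσ.continuousOn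
  obtain ⟨R₃, hR₃⟩ := hK.exists_bound_of_continuousOn hcv.continuousOn
  -- The margins `a / 2` and `1` absorb the change of `ρ`, `σ` and `v` for times near `t`; `φ` needs
  -- none, as its values remain in `[0, 1]`.
  set C : Set ((ℝ × ℝ) × (Vec d × Vec d)) := (Icc (a / 2) (R₁ + 1) ×ˢ Icc 0 1) ×ˢ
    (Metric.closedBall 0 (R₂ + 1) ×ˢ Metric.closedBall 0 (R₃ + 1)) with hCdef
  have hCc : IsCompact C := (isCompact_Icc.prod isCompact_Icc).prod
    ((isCompact_closedBall _ _).prod (isCompact_closedBall _ _))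
  have hCconv : Convex ℝ C := ((convex_Icc _ _).prod (convex_Icc _ _)).prod
    ((convex_closedBall _ _).prod (convex_closedBall _ _))
  have hCsub : C ⊆ Model.region ×ˢ univ := fun p hp =>
    ⟨⟨(half_pos ha).trans_le hp.1.1.1, hp.1.2⟩, mem_univ _⟩
  obtain ⟨L, hL⟩ := D.exists_lipschitzOnWith_totalDensity hCc hCconv hCsub
  have hsmall : ∀ c b : ℝ, 0 < b → ∀ᶠ s in nhds t, c * |s - t| ≤ b := by
    intro c b hb
    have : Continuous fun s : ℝ => c * |s - t| := by fun_prop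
    have h := this.tendsto t
    simp only [sub_self, abs_zero, mul_zero] at h
    exact (h.eventually_lt_const hb).mono fun _ h => h.le
  refine hasDerivAt_integral_comp hK hL (q := fun s x =>
    (((U s).ρ T x, (U s).φ T x), ((U s).σ T x, (U s).v T x))) (C := max (max Cρ Cφ) (max Cσ Cv))
    ?_ ?_ ?_ ?_ ?_
  · filter_upwards [hIcc, hρ, hσ, hv, hsmall Cρ (a / 2) (half_pos ha), hsmall Cρ 1 one_pos,
      hsmall Cσ 1 one_pos, hsmall Cv 1 one_pos] with s hs h1 h2 h3 h4 h5 h6 h7 x hx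
    have e1 := abs_le.1 ((h1 x hx).trans h4)
    have e2 := (le_abs_self _).trans ((h1 x hx).trans h5)
    have e3 : a ≤ (U t).ρ T x := hmin hx
    have e4 := (le_abs_self _).trans (hR₁ x hx)
    refine ⟨⟨⟨by linarith [e1.1], by linarith⟩, hU.φ_mem s hs T x hx⟩, ?_, ?_⟩
    · rw [mem_closedBall_zero_iff]
      calc _ ≤ ‖(U t).σ T x‖ + ‖(U s).σ T x - (U t).σ T x‖ := norm_le_insert' _ _
        _ ≤ R₂ + 1 := add_le_add (hR₂ x hx) ((h2 x hx).trans h6)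
    · rw [mem_closedBall_zero_iff]
      calc _ ≤ ‖(U t).v T x‖ + ‖(U s).v T x - (U t).v T x‖ := norm_le_insert' _ _
        _ ≤ R₃ + 1 := add_le_add (hR₃ x hx) ((h3 x hx).trans h7)
  · filter_upwards [hev] with s hs
    exact (((hcS _ hs.1 T).prodMk (hcS _ hs.2.2.1 T)).prodMk
      ((hcV _ hs.2.2.2.2.2.1 T).prodMk (hcV _ hs.2.1.1 T))).continuousOn
  · filter_upwards [hρ, hφ, hσ, hv] with s h1 h2 h3 h4 x hx
    have hab := abs_nonneg (s - t)
    simp only [Prod.mk_sub_mk, Prod.norm_mk]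
    refine max_le (max_le ((h1 x hx).trans ?_) ((h2 x hx).trans ?_))
      (max_le ((h3 x hx).trans ?_) ((h4 x hx).trans ?_)) <;>
    refine mul_le_mul_of_nonneg_right ?_ hab <;> simp
  · have c1 := hcS _ (hU.deriv_ρ_mem ht) T
    have c2 := hcS _ (hU.deriv_φ_mem ht) T
    have c3 := hcV _ (hU.deriv_σ_mem ht) T
    have c4 := hcV _ (hU.deriv_v_mem ht) T
    have c5 := hU.continuousOn_dρ ht T
    have c6 := hU.continuousOn_dφ ht T
    unfold energyRate
    exact ((((c5.mul c1.continuousOn).add (c6.mul c2.continuousOn)).add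
      (continuousOn_const.mul (c3.inner hcσ).continuousOn)).add
      ((continuous_const.mul (hcv.norm.pow 2)).mul c1).continuousOn).add
      (hcρ.mul (c4.inner hcv)).continuousOn
  · intro x hx
    have d1 := (hU.differentiableAt_ρ ht T x).hasDerivAt
    have d2 := (hU.differentiableAt_φ ht T x).hasDerivAt
    have d3 := (hU.differentiableAt_σ ht T x).hasDerivAt
    have d4 := (hU.differentiableAt_v ht T x).hasDerivAt
    have hreg : ∀ᶠ s in nhds t, ((U s).ρ T x, (U s).φ T x) ∈ Model.region := by
      filter_upwards [hIcc] with s hs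
      exact ⟨hU.ρ_pos s hs T x hx, hU.φ_mem s hs T x hx⟩
    have h := ((D.hasDerivAt_energyDensity d1 d2 hreg).add (d3.norm_sq.const_mul (D.γ / 2))).add
      ((d1.div_const 2).mul d4.norm_sq)
    refine h.congr_deriv ?_
    rw [energyRate, real_inner_comm ((U t).σ T x), real_inner_comm ((U t).v T x)]
    ring

end IsSemiDiscrete

end Energy

/-! ### Differential identities -/

section Identities

variable {d : ℕ}

theorem continuous_gradient {f : Vec d → ℝ} (hf : ContDiff ℝ 1 f) : Continuous (∇ f) :=
  (InnerProductSpace.toDual ℝ (Vec d)).symm.continuous.comp (hf.continuous_fderiv one_ne_zero)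

theorem continuous_divergence {w : Vec d → Vec d} (hw : ContDiff ℝ 1 w) :
    Continuous (divergence w) := by
  have : divergence w = fun x => ∑ i, fderiv ℝ w x (EuclideanSpace.single i 1) i := rfl
  rw [this]
  have := hw.continuous_fderiv one_ne_zero
  fun_prop

theorem continuous_divConvection {ρ : Vec d → ℝ} {v : Vec d → Vec d} (hρ : ContDiff ℝ 1 ρ)
    (hv : ContDiff ℝ 1 v) : Continuous (divConvection ρ v) := by
  unfold divConvection
  refine (PiLp.continuous_toLp 2 _).comp (continuous_pi fun i => ?_)
  exact continuous_divergence ((hρ.mul (contDiff_euclidean.1 hv i)).smul hv)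

theorem divergence_smul {a : Vec d → ℝ} {w : Vec d → Vec d} {x : Vec d}
    (ha : DifferentiableAt ℝ a x) (hw : DifferentiableAt ℝ w x) :
    divergence (fun y => a y • w y) x = a x * divergence w x + fderiv ℝ a x (w x) := by
  rw [divergence_eq_sum (w := fun y => a y • w y) (ha.smul hw), divergence_eq_sum hw, Finset.mul_sum]
  have hx : w x = ∑ i, w x i • EuclideanSpace.single i (1 : ℝ) := by
    ext j; simp [Pi.single_apply]
  conv_rhs => rw [hx, map_sum]
  rw [← Finset.sum_add_distrib]
  refine Finset.sum_congr rfl fun i _ => ?_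
  have hwi : DifferentiableAt ℝ (fun y => w y i) x := differentiableAt_euclidean.1 hw i
  have := fderiv_fun_mul ha hwi
  simp only [PiLp.smul_apply, smul_eq_mul]
  rw [this]
  simp

/-- The kinetic energy balance of the convective term. -/
theorem inner_divConvection {ρ : Vec d → ℝ} {v : Vec d → Vec d} {x : Vec d}
    (hρ : DifferentiableAt ℝ ρ x) (hv : DifferentiableAt ℝ v x) :
    inner ℝ (divConvection ρ v x) (v x) =
      divergence (fun y => ρ y • v y) x * ‖v x‖ ^ 2 +
        1 / 2 * ρ x * fderiv ℝ (fun y => ‖v y‖ ^ 2) x (v x) := by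
  have h1 : ∀ i, divConvection ρ v x i =
      v x i * divergence (fun y => ρ y • v y) x + ρ x * (fderiv ℝ v x (v x)) i := by
    intro i
    have hvi : DifferentiableAt ℝ (fun y => v y i) x := differentiableAt_euclidean.1 hv i
    -- With `v i` as scalar factor and `ρ v` as field, the product rule gives `div (ρ v ⊗ v) = div
    -- (ρ v) v + ρ (v · ∇) v`.
    have h2 : (fun y => (ρ y * v y i) • v y) = fun y => v y i • (ρ y • v y) := by
      ext1 y; rw [smul_smul, mul_comm]
    have h3 : fderiv ℝ (fun y => v y i) x =
        (EuclideanSpace.proj i : Vec d →L[ℝ] ℝ).comp (fderiv ℝ v x) :=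
      ((EuclideanSpace.proj i : Vec d →L[ℝ] ℝ).hasFDerivAt.comp x hv.hasFDerivAt).fderiv
    change divergence (fun y => (ρ y * v y i) • v y) x = _
    rw [h2, divergence_smul (w := fun y => ρ y • v y) hvi (hρ.smul hv), h3]
    simp
  have h4 : fderiv ℝ (fun y => ‖v y‖ ^ 2) x (v x) = 2 * inner ℝ (v x) (fderiv ℝ v x (v x)) := by
    rw [(hv.hasFDerivAt.norm_sq).fderiv]
    simp
  rw [h4, EuclideanSpace.real_norm_sq_eq, PiLp.inner_apply, PiLp.inner_apply]
  simp only [h1, RCLike.inner_apply, conj_trivial]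
  rw [Finset.mul_sum, Finset.mul_sum, Finset.mul_sum, ← Finset.sum_add_distrib]
  refine Finset.sum_congr rfl fun i _ => ?_
  ring

end Identities

/-! ### Linearity of the broken integrals -/

section Linear

variable {d : ℕ} {Ω : Set (Vec d)} {M : Triangulation d Ω}

/-- Continuity on every closed cell. -/
def CellContinuous (g : Broken M ℝ) : Prop :=
  ∀ T, ContinuousOn (g T) (convexHull ℝ (T.1 : Set (Vec d)))

theorem CellContinuous.integrableOn {g : Broken M ℝ} (hg : CellContinuous g) (T : M.Cell) :
    IntegrableOn (g T) (convexHull ℝ (T.1 : Set (Vec d))) :=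
  (hg T).integrableOn_compact (isCompact_convexHull_finset T.1)

theorem CellContinuous.add {g h : Broken M ℝ} (hg : CellContinuous g) (hh : CellContinuous h) :
    CellContinuous fun T x => g T x + h T x := fun T => (hg T).add (hh T)

theorem CellContinuous.sub {g h : Broken M ℝ} (hg : CellContinuous g) (hh : CellContinuous h) :
    CellContinuous fun T x => g T x - h T x := fun T => (hg T).sub (hh T)

theorem CellContinuous.const_mul {g : Broken M ℝ} (hg : CellContinuous g) (c : ℝ) :
    CellContinuous fun T x => c * g T x := fun T => continuousOn_const.mul (hg T)

theorem domainIntegral_add {g h : Broken M ℝ} (hg : CellContinuous g) (hh : CellContinuous h) :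
    domainIntegral (fun T x => g T x + h T x) = domainIntegral g + domainIntegral h := by
  simp only [domainIntegral, ← Finset.sum_add_distrib]
  exact Finset.sum_congr rfl fun T _ => integral_add (hg.integrableOn T) (hh.integrableOn T)

theorem domainIntegral_sub {g h : Broken M ℝ} (hg : CellContinuous g) (hh : CellContinuous h) :
    domainIntegral (fun T x => g T x - h T x) = domainIntegral g - domainIntegral h := by
  simp only [domainIntegral, ← Finset.sum_sub_distrib]
  exact Finset.sum_congr rfl fun T _ => integral_sub (hg.integrableOn T) (hh.integrableOn T)

theorem domainIntegral_const_mul (c : ℝ) (g : Broken M ℝ) :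
    domainIntegral (fun T x => c * g T x) = c * domainIntegral g := by
  simp only [domainIntegral, Finset.mul_sum]
  exact Finset.sum_congr rfl fun T _ => integral_const_mul c _

theorem domainIntegral_nonneg {g : Broken M ℝ}
    (hg : ∀ T : M.Cell, ∀ x ∈ convexHull ℝ (T.1 : Set (Vec d)), 0 ≤ g T x) :
    0 ≤ domainIntegral g :=
  Finset.sum_nonneg fun T _ =>
    setIntegral_nonneg (isCompact_convexHull_finset T.1).measurableSet (hg T)

theorem faceIntegral_nonneg {F : Finset (Vec d)} {g : Vec d → ℝ} (hg : ∀ x, 0 ≤ g x) :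
    0 ≤ faceIntegral F g :=
  integral_nonneg hg

theorem interfaceIntegral_add (hd : 0 < d) {G H : Finset (Vec d) → Vec d → ℝ}
    (hG : ∀ F, Continuous (G F)) (hH : ∀ F, Continuous (H F)) :
    interfaceIntegral M (fun F x => G F x + H F x) =
      interfaceIntegral M G + interfaceIntegral M H := by
  simp only [interfaceIntegral, ← Finset.sum_add_distrib]
  exact Finset.sum_congr rfl fun F hF =>
    faceIntegral_add hd (card_of_mem_facets M (mem_facets_of_mem_interfaces M hF)) (hG F) (hH F)

theorem interfaceIntegral_const_mul (c : ℝ) (G : Finset (Vec d) → Vec d → ℝ) :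
    interfaceIntegral M (fun F x => c * G F x) = c * interfaceIntegral M G := by
  simp only [interfaceIntegral, Finset.mul_sum]
  exact Finset.sum_congr rfl fun F _ => faceIntegral_const_mul F c (G F)

theorem interfaceIntegral_sub (hd : 0 < d) {G H : Finset (Vec d) → Vec d → ℝ}
    (hG : ∀ F, Continuous (G F)) (hH : ∀ F, Continuous (H F)) :
    interfaceIntegral M (fun F x => G F x - H F x) =
      interfaceIntegral M G - interfaceIntegral M H := by
  have h := interfaceIntegral_add (M := M) hd (H := fun F x => -1 * H F x) hG
    fun F => continuous_const.mul (hH F)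
  rw [interfaceIntegral_const_mul] at h
  simp only [neg_mul, one_mul, ← sub_eq_add_neg] at h
  exact h

theorem continuous_avg {V : Type} [NormedAddCommGroup V] [NormedSpace ℝ V] {u : Broken M V}
    (hu : ∀ T, Continuous (u T)) (F : Finset (Vec d)) : Continuous (avg u F) :=
  continuous_const.smul (continuous_finsetSum _ fun T _ => hu T)

theorem continuous_jump {u : Broken M ℝ} (hu : ∀ T, Continuous (u T)) (F : Finset (Vec d)) :
    Continuous (jump u F) :=
  continuous_finsetSum _ fun T _ => (hu T).smul continuous_const

theorem continuous_jumpV {w : Broken M (Vec d)} (hw : ∀ T, Continuous (w T))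
    (F : Finset (Vec d)) : Continuous (jumpV w F) :=
  continuous_finsetSum _ fun T _ => (hw T).inner continuous_const

/-- A coercive penalty form is nonnegative. -/
theorem Bh_nonneg {k : ℕ} {D : Model} {αB : ℝ} (hc : D.IsCoercivePenalty M k αB)
    {φ : Broken M ℝ} (hφ : φ ∈ Vh M k)
    (hφ' : ∀ T : M.Cell, ∀ x ∈ convexHull ℝ (T.1 : Set (Vec d)), φ T x ∈ Icc (0 : ℝ) 1)
    {w : Broken M (Vec d)} (hw : w ∈ VhZero M k) : 0 ≤ D.Bh αB φ w w := by
  obtain ⟨c, hc0, h⟩ := hc φ hφ hφ'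
  refine le_trans (mul_nonneg hc0.le ?_) (h w hw)
  have hfrob : ∀ A : Matrix (Fin d) (Fin d) ℝ, 0 ≤ frob A A := fun A =>
    Finset.sum_nonneg fun i _ => Finset.sum_nonneg fun j _ => mul_self_nonneg _
  have hface : ∀ F : Finset (Vec d),
      0 ≤ faceIntegral F fun x => (faceArea F)⁻¹ * frob (jumpT w F x) (jumpT w F x) := fun F =>
    faceIntegral_nonneg fun x => mul_nonneg (inv_nonneg.2 ENNReal.toReal_nonneg) (hfrob _)
  exact add_nonneg (domainIntegral_nonneg fun T x _ => hfrob _)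
    (add_nonneg (Finset.sum_nonneg fun F _ => hface F) (Finset.sum_nonneg fun F _ => hface F))

end Linear

/-! ### The energy balance -/

section Balance

variable {d : ℕ} {Ω : Set (Vec d)} {M : Triangulation d Ω} {k : ℕ} {D : Model} {αB : ℝ}
  {α₁ α₂ α₃ : ℝ} {t₁ : ℝ} {U : ℝ → State M}

/-- The equation for `σ`, differentiated in time. -/
theorem IsSemiDiscrete.gradient_σ_deriv (hd : 0 < d)
    (hU : IsSemiDiscrete D k αB (stabilizedFluxes M D α₁ α₂ α₃) t₁ U) {t : ℝ}
    (ht : t ∈ Ioo 0 t₁) {Z : Broken M (Vec d)} (hZ : Z ∈ VhNormal M k) :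
    0 = domainIntegral (M := M) (fun T x =>
          inner ℝ (deriv (fun s => (U s).σ T x) t - ∇ (fun y => deriv (fun s => (U s).φ T y) t) x)
            (Z T x))
        + interfaceIntegral M (fun F x =>
          inner ℝ (jump (fun T y => deriv (fun s => (U s).φ T y) t) F x) (avg Z F x)) := by
  have hZc : ∀ T, Continuous (Z T) := fun T => (contDiff_of_mem_VhVec hZ.1 T (n := 0)).continuous
  have hev := hU.eventually_mem ht
  have c1 : ∀ a ∈ VhVecSubmodule M k, CellContinuous fun T x => inner ℝ (a T x) (Z T x) :=
    fun a ha T => ((contDiff_of_mem_VhVec ha T (n := 0)).continuous.inner (hZc T)).continuousOn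
  have c2 : ∀ b ∈ VhSubmodule M k, CellContinuous fun T x => inner ℝ (∇ (b T) x) (Z T x) :=
    fun b hb T => ((continuous_gradient (contDiff_of_mem_Vh hb T)).inner (hZc T)).continuousOn
  have c3 : ∀ b ∈ VhSubmodule M k, ∀ F, Continuous fun x => inner ℝ (jump b F x) (avg Z F x) :=
    fun b hb F => (continuous_jump (fun T =>
      (contDiff_of_mem_Vh hb T (n := 0)).continuous) F).inner (continuous_avg hZc F)
  have h1 := (hasDerivAt_of_pointwise (VhVecSubmodule M k) (u := fun s => (U s).σ)
    (hev.mono fun _ h => h.2.2.2.2.2.1) (hU.differentiableAt_σ ht)).2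
    (fun a => domainIntegral (M := M) fun T x => inner ℝ (a T x) (Z T x))
    (fun a ha b hb => by
      simp only [Pi.add_apply, inner_add_left]
      exact domainIntegral_add (c1 a ha) (c1 b hb))
    (fun c a ha => by
      simp only [Pi.smul_apply, real_inner_smul_left]
      exact domainIntegral_const_mul c _)
  have h2 := (hasDerivAt_of_pointwise (VhSubmodule M k) (u := fun s => (U s).φ)
    (hev.mono fun _ h => h.2.2.1) (hU.differentiableAt_φ ht)).2
    (fun b => domainIntegral (M := M) fun T x => inner ℝ (∇ (b T) x) (Z T x))
    (fun a ha b hb => by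
      rw [← domainIntegral_add (c2 a ha) (c2 b hb)]
      simp only [inner_gradient_left]
      congr 1; funext T x
      rw [Pi.add_apply, fderiv_add ((contDiff_of_mem_Vh ha T (n := 1)).differentiable one_ne_zero x)
        ((contDiff_of_mem_Vh hb T (n := 1)).differentiable one_ne_zero x)]
      rfl)
    (fun c a ha => by
      rw [smul_eq_mul, ← domainIntegral_const_mul]
      simp only [inner_gradient_left]
      congr 1; funext T x
      rw [Pi.smul_apply, fderiv_const_smul
        ((contDiff_of_mem_Vh ha T (n := 1)).differentiable one_ne_zero x)]
      rfl)
  have h3 := (hasDerivAt_of_pointwise (VhSubmodule M k) (u := fun s => (U s).φ)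
    (hev.mono fun _ h => h.2.2.1) (hU.differentiableAt_φ ht)).2
    (fun b => interfaceIntegral M fun F x => inner ℝ (jump b F x) (avg Z F x))
    (fun a ha b hb => by
      rw [← interfaceIntegral_add hd (c3 a ha) (c3 b hb)]
      congr 1; funext F x
      simp only [jump, Pi.add_apply, add_smul, Finset.sum_add_distrib, inner_add_left])
    (fun c a ha => by
      rw [smul_eq_mul, ← interfaceIntegral_const_mul]
      congr 1; funext F x
      simp only [jump, Pi.smul_apply, smul_assoc, ← Finset.smul_sum, real_inner_smul_left])
  -- For a fixed test function the equation holds at all times near `t`. Its left side therefore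
  -- vanishes identically there, and each of its three terms is linear in `σ` or `φ`.
  have hzero : HasDerivAt (fun s =>
      domainIntegral (M := M) (fun T x => inner ℝ ((U s).σ T x) (Z T x)) -
      domainIntegral (M := M) (fun T x => inner ℝ (∇ ((U s).φ T) x) (Z T x)) +
      interfaceIntegral M (fun F x => inner ℝ (jump (U s).φ F x) (avg Z F x))) 0 t := by
    refine (hasDerivAt_const t (0 : ℝ)).congr_of_eventuallyEq ?_
    filter_upwards [hev, Ioo_mem_nhds ht.1 ht.2] with s hs hst
    have h := hU.gradient_σ s hst Z hZ
    simp only [inner_sub_left] at h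
    rw [domainIntegral_sub (c1 _ hs.2.2.2.2.2.1) (c2 _ hs.2.2.1)] at h
    exact h.symm
  have h := hzero.unique ((h1.sub h2).add h3)
  simp only [inner_sub_left]
  rw [domainIntegral_sub (c1 _ (hU.deriv_σ_mem ht)) (c2 _ (hU.deriv_φ_mem ht))]
  exact h

end Balance

/-! ### The energy dissipation identity -/

section Dissipation

variable {d : ℕ} {Ω : Set (Vec d)} {M : Triangulation d Ω} {k : ℕ} {D : Model} {αB : ℝ}
  {α₁ α₂ α₃ : ℝ} {t₁ : ℝ} {U : ℝ → State M}

/-- The discrete energy dissipation identity. -/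
theorem IsSemiDiscrete.domainIntegral_energyRate (hd : 0 < d) (hΩ : interior (closure Ω) = Ω)
    (hU : IsSemiDiscrete D k αB (stabilizedFluxes M D α₁ α₂ α₃) t₁ U) {t : ℝ}
    (ht : t ∈ Ioo 0 t₁) :
    domainIntegral (energyRate D U t) =
      - domainIntegral (M := M) (fun T x => D.η / (U t).ρ T x * (U t).μ T x ^ 2)
        - D.Bh αB (U t).φ (U t).v (U t).v
        - interfaceIntegral M (fun F x =>
            α₁ * ‖jump (U t).τ F x‖ ^ 2 + α₂ * jumpV (U t).v F x ^ 2
              + α₃ * ‖jump (U t).μ F x‖ ^ 2) := by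
  have htI := Ioo_subset_Icc_self ht
  obtain ⟨mρ, mv, mφ, mμ, mτ, mσ⟩ := hU.mem t htI
  have mρ' := hU.deriv_ρ_mem ht
  have mφ' := hU.deriv_φ_mem ht
  have mv' := hU.deriv_v_mem ht
  have mσ' := hU.deriv_σ_mem ht
  -- The choice of test functions: each equation is paired with the variable conjugate to it in the
  -- energy.
  have e1 := hU.mass t ht _ mτ
  have e2 := hU.momentum t ht _ mv
  have e3 := hU.phase t ht _ mμ
  have e4 := hU.potential_μ t ht _ mφ'
  have e5 := hU.potential_τ t ht _ mρ'
  have e6 := hU.gradient_σ_deriv hd ht mσ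
  have hρpos := hU.ρ_pos t htI
  have cdρ := hU.continuousOn_dρ ht
  have cdφ := hU.continuousOn_dφ ht
  set ρ := (U t).ρ
  set v := (U t).v
  set φ := (U t).φ
  set μ := (U t).μ
  set τ := (U t).τ
  set σ := (U t).σ
  set ρ' : Broken M ℝ := fun T x => deriv (fun s => (U s).ρ T x) t with hρ'
  set φ' : Broken M ℝ := fun T x => deriv (fun s => (U s).φ T x) t with hφ'
  set v' : Broken M (Vec d) := fun T x => deriv (fun s => (U s).v T x) t with hv'
  set σ' : Broken M (Vec d) := fun T x => deriv (fun s => (U s).σ T x) t with hσ'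
  have sρ : ∀ T, ContDiff ℝ 1 (ρ T) := fun T => contDiff_of_mem_Vh mρ T
  have sv : ∀ T, ContDiff ℝ 1 (v T) := fun T => contDiff_of_mem_VhVec mv.1 T
  have sφ : ∀ T, ContDiff ℝ 1 (φ T) := fun T => contDiff_of_mem_Vh mφ T
  have sμ : ∀ T, ContDiff ℝ 1 (μ T) := fun T => contDiff_of_mem_Vh mμ T
  have sτ : ∀ T, ContDiff ℝ 1 (τ T) := fun T => contDiff_of_mem_Vh mτ T
  have sσ : ∀ T, ContDiff ℝ 1 (σ T) := fun T => contDiff_of_mem_VhVec mσ.1 T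
  have sρ' : ∀ T, ContDiff ℝ 1 (ρ' T) := fun T => contDiff_of_mem_Vh mρ' T
  have sφ' : ∀ T, ContDiff ℝ 1 (φ' T) := fun T => contDiff_of_mem_Vh mφ' T
  have sv' : ∀ T, ContDiff ℝ 1 (v' T) := fun T => contDiff_of_mem_VhVec mv' T
  have sσ' : ∀ T, ContDiff ℝ 1 (σ' T) := fun T => contDiff_of_mem_VhVec mσ' T
  have kρ := fun T => (sρ T).continuous
  have kv := fun T => (sv T).continuous
  have kφ := fun T => (sφ T).continuous
  have kμ := fun T => (sμ T).continuous
  have kτ := fun T => (sτ T).continuous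
  have kσ := fun T => (sσ T).continuous
  have kρ' := fun T => (sρ' T).continuous
  have kφ' := fun T => (sφ' T).continuous
  have kv' := fun T => (sv' T).continuous
  have kσ' := fun T => (sσ' T).continuous
  have sρv : ∀ T, ContDiff ℝ 1 fun y => ρ T y • v T y := fun T => (sρ T).smul (sv T)
  have kdiv := fun T => continuous_divergence (sρv T)
  set I₁ : Broken M ℝ := fun T x => (ρ' T x + divergence (fun y => ρ T y • v T y) x) * τ T x
  set I₂ : Broken M ℝ := fun T x => inner ℝ
    (ρ T x • v' T x + divConvection (ρ T) (v T) x
      - divergence (fun y => ρ T y • v T y) x • v T x + ρ T x • ∇ (τ T) x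
      - μ T x • ∇ (φ T) x - ((1 / 2 : ℝ) * ρ T x) • ∇ (fun y => ‖v T y‖ ^ 2) x) (v T x)
  set I₃ : Broken M ℝ := fun T x =>
    (φ' T x + inner ℝ (v T x) (∇ (φ T) x) + D.η * (μ T x / ρ T x)) * μ T x
  set I₄ : Broken M ℝ := fun T x =>
    (μ T x - D.dφ (ρ T x) (φ T x) + D.γ * divergence (σ T) x) * φ' T x
  set I₅ : Broken M ℝ := fun T x =>
    (τ T x - D.dρ (ρ T x) (φ T x) - 1 / 2 * ‖v T x‖ ^ 2) * ρ' T x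
  set I₆ : Broken M ℝ := fun T x => inner ℝ (σ' T x - ∇ (φ' T) x) (σ T x)
  set J₁ : Broken M ℝ := fun T x => divergence (fun y => τ T y • (ρ T y • v T y)) x
  set J₂ : Broken M ℝ := fun T x => divergence (fun y => φ' T y • σ T y) x
  set P : Broken M ℝ := fun T x => D.η / ρ T x * μ T x ^ 2
  have hI₁ : CellContinuous I₁ := fun T => (((kρ' T).add (kdiv T)).mul (kτ T)).continuousOn
  have hI₂ : CellContinuous I₂ := fun T => by
    have g1 := continuous_gradient (sτ T)
    have g2 := continuous_gradient (sφ T)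
    have g3 := continuous_gradient ((sv T).norm_sq ℝ)
    have g4 := continuous_divConvection (sρ T) (sv T)
    exact ((((((((kρ T).smul (kv' T)).add g4).sub ((kdiv T).smul (kv T))).add
      ((kρ T).smul g1)).sub ((kμ T).smul g2)).sub
      ((continuous_const.mul (kρ T)).smul g3)).inner (kv T)).continuousOn
  have hquot : ∀ T, ContinuousOn (fun x => μ T x / ρ T x) (convexHull ℝ (T.1 : Set (Vec d))) :=
    fun T => (kμ T).continuousOn.div (kρ T).continuousOn fun x hx => (hρpos T x hx).ne'
  have hI₃ : CellContinuous I₃ := fun T =>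
    ((((kφ' T).add ((kv T).inner (continuous_gradient (sφ T)))).continuousOn.add
      (continuousOn_const.mul (hquot T))).mul (kμ T).continuousOn)
  have hI₄ : CellContinuous I₄ := fun T =>
    (((kμ T).continuousOn.sub (cdφ T)).add
      (continuous_const.mul (continuous_divergence (sσ T))).continuousOn).mul (kφ' T).continuousOn
  have hI₅ : CellContinuous I₅ := fun T =>
    (((kτ T).continuousOn.sub (cdρ T)).sub
      (continuous_const.mul ((kv T).norm.pow 2)).continuousOn).mul (kρ' T).continuousOn
  have hI₆ : CellContinuous I₆ := fun T =>
    (((kσ' T).sub (continuous_gradient (sφ' T))).inner (kσ T)).continuousOn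
  have hJ₁ : CellContinuous J₁ := fun T =>
    (continuous_divergence ((sτ T).smul (sρv T))).continuousOn
  have hJ₂ : CellContinuous J₂ := fun T =>
    (continuous_divergence ((sφ' T).smul (sσ T))).continuousOn
  have hP : CellContinuous P := fun T =>
    ((continuousOn_const.div (kρ T).continuousOn fun x hx => (hρpos T x hx).ne').mul
      ((kμ T).pow 2).continuousOn)
  -- The energy rate equals, at each point, the tested residuals plus two exact divergences and the
  -- dissipation; all other terms cancel.
  have hpt : energyRate D U t = fun T x =>
      I₁ T x + I₂ T x + I₃ T x - I₄ T x - I₅ T x + D.γ * I₆ T x - J₁ T x + D.γ * J₂ T x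
        - P T x := by
    funext T x
    have hJ1 : J₁ T x = τ T x * divergence (fun y => ρ T y • v T y) x +
        ρ T x * fderiv ℝ (τ T) x (v T x) := by
      change divergence (fun y => τ T y • (ρ T y • v T y)) x = _
      rw [divergence_smul (w := fun y => ρ T y • v T y) ((sτ T).differentiable one_ne_zero x)
        ((sρv T).differentiable one_ne_zero x), map_smul, smul_eq_mul]
    have hJ2 : J₂ T x = φ' T x * divergence (σ T) x + fderiv ℝ (φ' T) x (σ T x) :=
      divergence_smul ((sφ' T).differentiable one_ne_zero x) ((sσ T).differentiable one_ne_zero x)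
    -- The terms `-div (ρ v) v` and `-½ ρ ∇|v|²` of the scheme cancel the convective term when
    -- tested with `v`.
    have hI2 : I₂ T x = ρ T x * inner ℝ (v' T x) (v T x) + ρ T x * fderiv ℝ (τ T) x (v T x)
        - μ T x * fderiv ℝ (φ T) x (v T x) := by
      change inner ℝ (_ : Vec d) _ = _
      simp only [inner_add_left, inner_sub_left, real_inner_smul_left, inner_gradient_left,
        real_inner_self_eq_norm_sq]
      rw [inner_divConvection ((sρ T).differentiable one_ne_zero x)
        ((sv T).differentiable one_ne_zero x)]
      ring
    have hI3 : I₃ T x = (φ' T x + fderiv ℝ (φ T) x (v T x) + D.η * (μ T x / ρ T x)) * μ T x := by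
      change (φ' T x + inner ℝ (v T x) (∇ (φ T) x) + _) * _ = _
      rw [real_inner_comm, inner_gradient_left]
    have hI6 : I₆ T x = inner ℝ (σ' T x) (σ T x) - fderiv ℝ (φ' T) x (σ T x) := by
      change inner ℝ (σ' T x - ∇ (φ' T) x) (σ T x) = _
      rw [inner_sub_left, inner_gradient_left]
    change D.dρ (ρ T x) (φ T x) * ρ' T x + D.dφ (ρ T x) (φ T x) * φ' T x
      + D.γ * inner ℝ (σ' T x) (σ T x) + 1 / 2 * ‖v T x‖ ^ 2 * ρ' T x
      + ρ T x * inner ℝ (v' T x) (v T x) = _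
    rw [hJ1, hJ2, hI2, hI3, hI6]
    simp only [I₁, I₄, I₅, P]
    ring
  have hsum : domainIntegral (energyRate D U t) =
      domainIntegral I₁ + domainIntegral I₂ + domainIntegral I₃ - domainIntegral I₄
        - domainIntegral I₅ + D.γ * domainIntegral I₆ - domainIntegral J₁
        + D.γ * domainIntegral J₂ - domainIntegral P := by
    have h12 := hI₁.add hI₂
    have h13 := h12.add hI₃
    have h14 := h13.sub hI₄
    have h15 := h14.sub hI₅
    have h16 := h15.add (hI₆.const_mul D.γ)
    have h17 := h16.sub hJ₁
    have h18 := h17.add (hJ₂.const_mul D.γ)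
    rw [hpt, domainIntegral_sub h18 hP, domainIntegral_add h17 (hJ₂.const_mul D.γ),
      domainIntegral_sub h16 hJ₁, domainIntegral_add h15 (hI₆.const_mul D.γ),
      domainIntegral_sub h14 hI₅, domainIntegral_sub h13 hI₄, domainIntegral_add h12 hI₃,
      domainIntegral_add hI₁ hI₂, domainIntegral_const_mul, domainIntegral_const_mul]
  -- Integration by parts leaves no boundary term, by the zero trace of `v` here and the zero normal
  -- trace of `σ` for `J₂`.
  have hJ₁i : domainIntegral J₁ = _ := domainIntegral_divergence_smul hd hΩ (a := τ)
    (w := fun T y => ρ T y • v T y) sτ sρv fun F hF T hT x hx => by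
      simp only [mv.2 F hF T hT x hx, smul_zero, inner_zero_left]
  have hJ₂i : domainIntegral J₂ = _ := domainIntegral_divergence_smul hd hΩ sφ' sσ mσ.2
  set S₁ : Finset (Vec d) → Vec d → ℝ := fun F x =>
    jumpV (fun T y => ρ T y • v T y) F x * avg τ F x +
      inner ℝ (jump τ F x) (avg (fun T y => ρ T y • v T y) F x)
  set S₂ : Finset (Vec d) → Vec d → ℝ := fun F x =>
    jumpV σ F x * avg φ' F x + inner ℝ (jump φ' F x) (avg σ F x)
  set S₃ : Finset (Vec d) → Vec d → ℝ := fun F x => inner ℝ (jump φ' F x) (avg σ F x)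
  set G₁ : Finset (Vec d) → Vec d → ℝ := (stabilizedFluxes M D α₁ α₂ α₃).F₁ (U t) τ
  set G₂ : Finset (Vec d) → Vec d → ℝ := (stabilizedFluxes M D α₁ α₂ α₃).F₂ (U t) v
  set G₃ : Finset (Vec d) → Vec d → ℝ := (stabilizedFluxes M D α₁ α₂ α₃).F₃ (U t) μ
  set G₄ : Finset (Vec d) → Vec d → ℝ := (stabilizedFluxes M D α₁ α₂ α₃).F₄ (U t) φ'
  set R : Finset (Vec d) → Vec d → ℝ := fun F x =>
    α₁ * ‖jump τ F x‖ ^ 2 + α₂ * jumpV v F x ^ 2 + α₃ * ‖jump μ F x‖ ^ 2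
  have kρv := fun T => (sρv T).continuous
  have kμv : ∀ T, Continuous fun y => μ T y • v T y := fun T => (kμ T).smul (kv T)
  have hS₁ : ∀ F, Continuous (S₁ F) := fun F =>
    ((continuous_jumpV kρv F).mul (continuous_avg kτ F)).add
      ((continuous_jump kτ F).inner (continuous_avg kρv F))
  have hS₃ : ∀ F, Continuous (S₃ F) := fun F =>
    (continuous_jump kφ' F).inner (continuous_avg kσ F)
  have hS₂ : ∀ F, Continuous (S₂ F) := fun F =>
    ((continuous_jumpV kσ F).mul (continuous_avg kφ' F)).add (hS₃ F)
  have hG₁ : ∀ F, Continuous (G₁ F) := fun F =>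
    ((continuous_jumpV kρv F).mul (continuous_avg kτ F)).neg.add
      (continuous_const.mul ((continuous_jump kτ F).inner (continuous_jump kτ F)))
  have hG₂ : ∀ F, Continuous (G₂ F) := fun F =>
    ((((continuous_jump kτ F).inner (continuous_avg kρv F)).neg.add
      ((continuous_jump kφ F).inner (continuous_avg kμv F)))).add
      (continuous_const.mul ((continuous_jumpV kv F).mul (continuous_jumpV kv F)))
  have hG₃ : ∀ F, Continuous (G₃ F) := fun F =>
    ((continuous_jump kφ F).inner (continuous_avg kμv F)).neg.add
      (continuous_const.mul ((continuous_jump kμ F).inner (continuous_jump kμ F)))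
  have hG₄ : ∀ F, Continuous (G₄ F) := fun F =>
    (continuous_const.mul ((continuous_jumpV kσ F).mul (continuous_avg kφ' F))).neg
  -- The averages in the fluxes are those of the product rule, so all consistent terms cancel and
  -- only the penalties remain.
  have hRpt : R = fun F x => G₁ F x + G₂ F x + G₃ F x - G₄ F x + D.γ * S₃ F x + S₁ F x
      - D.γ * S₂ F x := by
    funext F x
    have g1 : G₁ F x = -(jumpV (fun T y => ρ T y • v T y) F x * avg τ F x)
        + α₁ * inner ℝ (jump τ F x) (jump τ F x) := rfl
    have g2 : G₂ F x = -inner ℝ (jump τ F x) (avg (fun T y => ρ T y • v T y) F x)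
        + inner ℝ (jump φ F x) (avg (fun T y => μ T y • v T y) F x)
        + α₂ * (jumpV v F x * jumpV v F x) := rfl
    have g3 : G₃ F x = -inner ℝ (jump φ F x) (avg (fun T y => μ T y • v T y) F x)
        + α₃ * inner ℝ (jump μ F x) (jump μ F x) := rfl
    have g4 : G₄ F x = -(D.γ * (jumpV σ F x * avg φ' F x)) := rfl
    rw [g1, g2, g3, g4]
    simp only [R, S₁, S₂, S₃, real_inner_self_eq_norm_sq]
    ring
  have hR : interfaceIntegral M R = interfaceIntegral M G₁ + interfaceIntegral M G₂
      + interfaceIntegral M G₃ - interfaceIntegral M G₄ + D.γ * interfaceIntegral M S₃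
      + interfaceIntegral M S₁ - D.γ * interfaceIntegral M S₂ := by
    have h12 : ∀ F, Continuous fun x => G₁ F x + G₂ F x := fun F => (hG₁ F).add (hG₂ F)
    have h13 : ∀ F, Continuous fun x => G₁ F x + G₂ F x + G₃ F x := fun F => (h12 F).add (hG₃ F)
    have h14 : ∀ F, Continuous fun x => G₁ F x + G₂ F x + G₃ F x - G₄ F x :=
      fun F => (h13 F).sub (hG₄ F)
    have c3 : ∀ F, Continuous fun x => D.γ * S₃ F x := fun F => continuous_const.mul (hS₃ F)
    have c2 : ∀ F, Continuous fun x => D.γ * S₂ F x := fun F => continuous_const.mul (hS₂ F)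
    have h15 : ∀ F, Continuous fun x => G₁ F x + G₂ F x + G₃ F x - G₄ F x + D.γ * S₃ F x :=
      fun F => (h14 F).add (c3 F)
    have h16 : ∀ F, Continuous fun x =>
        G₁ F x + G₂ F x + G₃ F x - G₄ F x + D.γ * S₃ F x + S₁ F x := fun F => (h15 F).add (hS₁ F)
    rw [hRpt, interfaceIntegral_sub hd h16 c2, interfaceIntegral_add hd h15 hS₁,
      interfaceIntegral_add hd h14 c3, interfaceIntegral_sub hd h13 hG₄,
      interfaceIntegral_add hd h12 hG₃, interfaceIntegral_add hd hG₁ hG₂,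
      interfaceIntegral_const_mul, interfaceIntegral_const_mul]
  have e5' : interfaceIntegral M ((stabilizedFluxes M D α₁ α₂ α₃).F₅ (U t) ρ') = 0 := by
    simp [interfaceIntegral, faceIntegral, stabilizedFluxes]
  rw [e5'] at e5
  rw [hsum, hR, hJ₁i, hJ₂i]
  linear_combination -e1 - e2 - e3 + e4 + e5 - D.γ * e6

end Dissipation

end

end NSAC

open NSAC in
theorem mainTheorem2 {d : ℕ} (hd : 0 < d) {Ω : Set (Vec d)} (hΩ : interior (closure Ω) = Ω)
    (M : Triangulation d Ω) (k : ℕ) (D : Model)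
    (αB : ℝ) (hαB : 0 < αB) (hcoercive : D.IsCoercivePenalty M k αB)
    (α₁ α₂ α₃ : ℝ) (hα₁ : 0 ≤ α₁) (hα₂ : 0 ≤ α₂) (hα₃ : 0 ≤ α₃)
    (t₁ : ℝ) (U : ℝ → State M)
    (hU : IsSemiDiscrete D k αB (stabilizedFluxes M D α₁ α₂ α₃) t₁ U) :
    ∀ t ∈ Set.Ioo 0 t₁,
      HasDerivAt (fun s => D.energy (U s))
        (- domainIntegral (M := M) (fun T x => D.η / (U t).ρ T x * (U t).μ T x ^ 2)
          - D.Bh αB (U t).φ (U t).v (U t).v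
          - interfaceIntegral M (fun F x =>
              α₁ * ‖jump (U t).τ F x‖ ^ 2 + α₂ * jumpV (U t).v F x ^ 2
                + α₃ * ‖jump (U t).μ F x‖ ^ 2)) t ∧
      - domainIntegral (M := M) (fun T x => D.η / (U t).ρ T x * (U t).μ T x ^ 2)
          - D.Bh αB (U t).φ (U t).v (U t).v
          - interfaceIntegral M (fun F x =>
              α₁ * ‖jump (U t).τ F x‖ ^ 2 + α₂ * jumpV (U t).v F x ^ 2
                + α₃ * ‖jump (U t).μ F x‖ ^ 2) ≤ 0 := by
  intro t ht
  have htI := Set.Ioo_subset_Icc_self ht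
  have hmem := hU.mem t htI
  refine ⟨?_, ?_⟩
  · rw [← hU.domainIntegral_energyRate hd hΩ ht]
    exact hU.hasDerivAt_energy ht
  · have h1 : 0 ≤ domainIntegral (M := M) (fun T x => D.η / (U t).ρ T x * (U t).μ T x ^ 2) :=
      domainIntegral_nonneg fun T x hx =>
        mul_nonneg (div_nonneg D.η_pos.le (hU.ρ_pos t htI T x hx).le) (sq_nonneg _)
    have h2 := Bh_nonneg hcoercive hmem.2.2.1 (hU.φ_mem t htI) hmem.2.1
    have h3 : 0 ≤ interfaceIntegral M (fun F x =>
        α₁ * ‖jump (U t).τ F x‖ ^ 2 + α₂ * jumpV (U t).v F x ^ 2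
          + α₃ * ‖jump (U t).μ F x‖ ^ 2) :=
      Finset.sum_nonneg fun F _ => faceIntegral_nonneg fun x => by positivity
    linarith
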